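/- For a domain $\Omega\subseteq\mathbb{C}$ let $\mathcal{M}(\Omega)$ be the set of meromorphic functions on $\Omega$, regarded as functions with values in the Riemann sphere $\hat{\mathbb{C}}=\mathbb{C}\cup\{\infty\}$ (the constant $\infty$ not being included), with the topology of locally uniform convergence with respect to the chordal metric $$\chi(z,w)=\frac{|z-w|}{\sqrt{1+|z|^2}\,\sqrt{1+|w|^2}}\quad(z,w\in\mathbb{C}),\qquad \chi(z,\infty)=\chi(\infty,z)=\frac{1}{\sqrt{1+|z|^2}}\quad(z\in\mathbb{C}),\qquad \chi(\infty,\infty)=0.$$ A function $f\in\mathcal{M}(\Omega)$ is called locally univalent if it has at most simple poles and $f'(z)\neq 0$ for all $z\in\Omega$ with $f(z)\neq\infty$. Let $\mathcal{M}_{l.u.}(\Omega)\subseteq\mathcal{M}(\Omega)$ be the subspace of all locally univalent functions. Then there exists a function $f\in\mathcal{M}_{l.u.}(\mathbb{C})$ such that for every simply connected domain $\Omega\subseteq\mathbb{C}$ the set $\{f(\cdot+n)|_{\Omega} : n=1,2,3,\dots\}$ is dense in $\mathcal{M}_{l.u.}(\Omega)$. -/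

import Mathlib

open TopologicalSpace

noncomputable section

/-- The Riemann sphere `ℂ ∪ {∞}`. It is a separate name for `OnePoint ℂ`, so that it can carry the
chordal metric. -/
def RiemannSphere : Type := OnePoint ℂ

namespace RiemannSphere

/-- The point at infinity. -/
def infty : RiemannSphere := (none : Option ℂ)

/-- The value of a finite point of the sphere, with the convention `∞ ↦ 0`. -/
def toComplex : RiemannSphere → ℂ
  | none => 0
  | some z => z

/-- The chordal distance `χ`. -/
def chordal : RiemannSphere → RiemannSphere → ℝ
  | some z, some w => ‖z - w‖ / (√(1 + ‖z‖ ^ 2) * √(1 + ‖w‖ ^ 2))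
  | some z, none => 1 / √(1 + ‖z‖ ^ 2)
  | none, some w => 1 / √(1 + ‖w‖ ^ 2)
  | none, none => 0

/-- The embedding of the sphere in `ℂ × ℝ` as the sphere of radius `1/2` about `(0, 1/2)`; it is
used only to prove the triangle inequality for `χ`. -/
def embed : RiemannSphere → WithLp 2 (ℂ × ℝ)
  | some z => WithLp.toLp 2 ((1 / (1 + ‖z‖ ^ 2) : ℝ) • z, ‖z‖ ^ 2 / (1 + ‖z‖ ^ 2))
  | none => WithLp.toLp 2 (0, 1)

theorem chordal_eq_dist_embed (p q : RiemannSphere) : chordal p q = dist (embed p) (embed q) := by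
  have key : ∀ z : ℂ, (0 : ℝ) < 1 + ‖z‖ ^ 2 := fun z => by positivity
  rcases p with _ | z <;> rcases q with _ | w
  · simp [chordal]
  · have hw := key w
    rw [WithLp.prod_dist_eq_of_L2]
    simp only [chordal, embed, WithLp.toLp_fst, WithLp.toLp_snd, dist_eq_norm, zero_sub, norm_neg, norm_smul, Real.norm_eq_abs,
      sq_abs, mul_pow]
    rw [← Real.sqrt_one, ← Real.sqrt_div zero_le_one]
    congr 1
    simp only [Real.sqrt_one]
    field_simp
    ring
  · have hz := key z
    rw [WithLp.prod_dist_eq_of_L2]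
    simp only [chordal, embed, WithLp.toLp_fst, WithLp.toLp_snd, dist_eq_norm, sub_zero, norm_smul, Real.norm_eq_abs,
      sq_abs, mul_pow]
    rw [← Real.sqrt_one, ← Real.sqrt_div zero_le_one]
    congr 1
    simp only [Real.sqrt_one]
    field_simp
    ring
  · have hz := key z
    have hw := key w
    rw [WithLp.prod_dist_eq_of_L2]
    simp only [chordal, embed, WithLp.toLp_fst, WithLp.toLp_snd, dist_eq_norm, Real.norm_eq_abs, sq_abs]
    rw [← Real.sqrt_mul hz.le, ← Real.sqrt_sq (norm_nonneg (z - w)),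
      ← Real.sqrt_div (sq_nonneg _)]
    congr 1
    simp only [Complex.sq_norm, Complex.normSq_apply, Complex.sub_re, Complex.sub_im,
      Complex.smul_re, Complex.smul_im, smul_eq_mul] at hz hw ⊢
    field_simp
    ring

/-- The Riemann sphere is a metric space under the chordal metric. -/
instance : MetricSpace RiemannSphere where
  dist := chordal
  dist_self p := by rw [chordal_eq_dist_embed, dist_self]
  dist_comm p q := by
    rw [chordal_eq_dist_embed, chordal_eq_dist_embed, dist_comm]
  dist_triangle p q r := by
    simp only [chordal_eq_dist_embed]
    exact dist_triangle _ _ _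
  eq_of_dist_eq_zero {p q} h := by
    have key : ∀ z : ℂ, √(1 + ‖z‖ ^ 2) ≠ 0 := fun z => by positivity
    change chordal p q = 0 at h
    rcases p with _ | z <;> rcases q with _ | w
    · rfl
    · simp [chordal, key] at h
    · simp [chordal, key] at h
    · simp only [chordal, div_eq_zero_iff, mul_eq_zero, key, or_false, norm_eq_zero,
        sub_eq_zero] at h
      rw [h]

end RiemannSphere

/-- The complex-valued function on `ℂ` attached to `f : Ω → ℂ ∪ {∞}`: it is `f` where `f` is
defined and finite, and `0` elsewhere. -/
def finitePart {Ω : Opens ℂ} (f : Ω → RiemannSphere) : ℂ → ℂ := by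
  classical exact fun z => if h : z ∈ Ω then (f ⟨z, h⟩).toComplex else 0

/-- The set `𝓜(Ω)` of meromorphic functions on the open set `Ω`, as sphere-valued functions: they
are analytic at every point of `Ω` where they are finite, and every point of `Ω` where they take
the value `∞` is a pole. (Poles are isolated, so the function that is constantly `∞` is not
included.) -/
structure MeromorphicFunction (Ω : Opens ℂ) where
  toFun : Ω → RiemannSphere
  analyticAt : ∀ z : Ω, toFun z ≠ RiemannSphere.infty → AnalyticAt ℂ (finitePart toFun) z
  pole : ∀ z : Ω, toFun z = RiemannSphere.infty →
    MeromorphicAt (finitePart toFun) z ∧ meromorphicOrderAt (finitePart toFun) z < 0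

instance {Ω : Opens ℂ} : CoeFun (MeromorphicFunction Ω) (fun _ => Ω → RiemannSphere) :=
  ⟨MeromorphicFunction.toFun⟩

/-- The topology of locally uniform convergence with respect to the chordal metric, that is (`Ω`
being locally compact), of uniform convergence on the compact subsets of `Ω`. -/
instance {Ω : Opens ℂ} : TopologicalSpace (MeromorphicFunction Ω) :=
  TopologicalSpace.induced
    (fun f => UniformOnFun.ofFun {K : Set Ω | IsCompact K} f.toFun) inferInstance

/-- A meromorphic function is locally univalent if it has at most simple poles and its derivative
does not vanish at any point where it is finite. -/
def MeromorphicFunction.IsLocallyUnivalent {Ω : Opens ℂ} (f : MeromorphicFunction Ω) : Prop :=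
  (∀ z : Ω, f z = RiemannSphere.infty → -1 ≤ meromorphicOrderAt (finitePart f) z) ∧
  (∀ z : Ω, f z ≠ RiemannSphere.infty → deriv (finitePart f) z ≠ 0)

/-- The space `𝓜_{l.u.}(Ω)` of locally univalent meromorphic functions on `Ω`, with the subspace
topology. -/
abbrev LocallyUnivalentFunction (Ω : Opens ℂ) : Type :=
  {f : MeromorphicFunction Ω // f.IsLocallyUnivalent}

/-- The function `z ↦ f (z + a)` on `Ω`, for `f` defined on `ℂ`. -/
def translateFun (f : (⊤ : Opens ℂ) → RiemannSphere) (a : ℂ) (Ω : Opens ℂ) : Ω → RiemannSphere :=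
  fun z => f ⟨(z : ℂ) + a, trivial⟩

theorem finitePart_translateFun (f : (⊤ : Opens ℂ) → RiemannSphere) (a : ℂ) (Ω : Opens ℂ)
    (z : Ω) :
    finitePart (translateFun f a Ω) =ᶠ[nhds (z : ℂ)] (fun w => finitePart f (w + a)) := by
  filter_upwards [Ω.isOpen.mem_nhds z.2] with w hw
  have hw' : w ∈ Ω := hw
  simp [finitePart, translateFun, hw']

/-- The restriction to `Ω` of the translate `f(· + a)` of a meromorphic function `f` on `ℂ`. -/
def MeromorphicFunction.translate (f : MeromorphicFunction ⊤) (a : ℂ) (Ω : Opens ℂ) :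
    MeromorphicFunction Ω where
  toFun := translateFun f a Ω
  analyticAt z hz := by
    rw [analyticAt_congr (finitePart_translateFun f a Ω z)]
    have h := f.analyticAt ⟨(z : ℂ) + a, trivial⟩ hz
    exact h.comp_of_eq (f := fun w : ℂ => w + a) (by fun_prop) rfl
  pole z hz := by
    have h := f.pole ⟨(z : ℂ) + a, trivial⟩ hz
    have e := (finitePart_translateFun f a Ω z).filter_mono
      (nhdsWithin_le_nhds (s := {(z : ℂ)}ᶜ))
    rw [MeromorphicAt.meromorphicAt_congr e, meromorphicOrderAt_congr e]
    rw [meromorphicAt_fun_comp_add_const_iff_meromorphicAt,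
      meromorphicOrderAt_fun_comp_add_const_eq_meromorphicOrderAt]
    exact h

/-- The restriction to `Ω` of the translate `f(· + a)` of a locally univalent meromorphic function
`f` on `ℂ`. -/
def LocallyUnivalentFunction.translate (f : LocallyUnivalentFunction ⊤) (a : ℂ) (Ω : Opens ℂ) :
    LocallyUnivalentFunction Ω :=
  ⟨f.1.translate a Ω, by
    refine ⟨fun z hz => ?_, fun z hz => ?_⟩
    · have h := f.2.1 ⟨(z : ℂ) + a, trivial⟩ hz
      have e := (finitePart_translateFun f.1 a Ω z).filter_mono
        (nhdsWithin_le_nhds (s := {(z : ℂ)}ᶜ))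
      change -1 ≤ meromorphicOrderAt (finitePart (translateFun f.1 a Ω)) z
      rw [meromorphicOrderAt_congr e, meromorphicOrderAt_fun_comp_add_const_eq_meromorphicOrderAt]
      exact h
    · have h := f.2.2 ⟨(z : ℂ) + a, trivial⟩ hz
      change deriv (finitePart (translateFun f.1 a Ω)) z ≠ 0
      rw [(finitePart_translateFun f.1 a Ω z).deriv_eq, deriv_comp_add_const]
      exact h⟩

end

open Set Filter Topology Metric MeasureTheory

/-! ### Second order linear differential equations -/

/-! Locally univalent functions are the quotients `x / y` of two independent solutions of an
equation `v'' = p v' + q v`. If the Wronskian has no zeros, then `x / y` has derivative `W / y ^ 2`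
and simple poles. Conversely, on a compact set a locally univalent function is a quotient of
holomorphic functions with nonvanishing Wronskian, and Cramer's rule recovers `p` and `q`.
Coefficients are subject to no nonvanishing condition, so all approximation is done on them.
Solutions depend continuously on coefficients (Grönwall), and the Wronskian, having no zeros by
Abel's formula, keeps every quotient locally univalent.

This reduces the theorem to entire equations. On a simply connected domain, Runge's theorem replaces
`p` and `q` by polynomials (`LocallyUnivalentFunction.exists_entire_approx`). It then suffices to
find one entire coefficient `c` whose fundamental pair, translated by positive integers,
approximates every independent pair of solutions of every entire equation
(`entireCoeff.exists_universal`).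

Such a `c` exists by Baire's theorem in the space of entire coefficients. The coefficients that
visit a given pair form an open set, and density is the fusion lemma `exists_fusion`: a given
equation is kept on a large disc and joined along a real segment to a translate of the target
equation, so that the given fundamental pair arrives at the target pair. The joining pair of
functions is a Hermite interpolant, composed with a slightly deformed complex path so that its
Wronskian has no zeros on the segment. The resulting continuous coefficient becomes entire by
Gaussian convolution, which is uniformly accurate on the segment and on the two end discs. No
closeness is needed elsewhere in the plane.

Runge's theorem comes from Banach algebras: the hull of `K` is the spectrum of the coordinate in the
closure of the polynomials in `C(K)`, and a Cauchy–Pompeiu integral of the resolvent provides the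
functional calculus. -/

theorem HasDerivAt.fst_comp {𝕜 : Type*} [NontriviallyNormedField 𝕜] {E F : Type*}
    [NormedAddCommGroup E] [NormedSpace 𝕜 E] [NormedAddCommGroup F] [NormedSpace 𝕜 F]
    {x : 𝕜 → E × F} {x' : E × F} {z : 𝕜} (h : HasDerivAt x x' z) :
    HasDerivAt (fun z => (x z).1) x'.1 z := by
  simpa using h.hasFDerivAt.fst.hasDerivAt

theorem HasDerivAt.snd_comp {𝕜 : Type*} [NontriviallyNormedField 𝕜] {E F : Type*}
    [NormedAddCommGroup E] [NormedSpace 𝕜 E] [NormedAddCommGroup F] [NormedSpace 𝕜 F]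
    {x : 𝕜 → E × F} {x' : E × F} {z : 𝕜} (h : HasDerivAt x x' z) :
    HasDerivAt (fun z => (x z).2) x'.2 z := by
  simpa using h.hasFDerivAt.snd.hasDerivAt

/-- The right-hand side of the first order system attached to `v'' = c.1 v' + c.2 v`; the state is
`x = (v, v')`. -/
def companion (c x : ℂ × ℂ) : ℂ × ℂ := (x.2, c.2 * x.1 + c.1 * x.2)

theorem norm_companion_le (c x : ℂ × ℂ) : ‖companion c x‖ ≤ (1 + 2 * ‖c‖) * ‖x‖ := by
  have h1 := norm_fst_le c
  have h2 := norm_snd_le c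
  have h3 := norm_fst_le x
  have h4 := norm_snd_le x
  have hc := norm_nonneg c
  have hx := norm_nonneg x
  refine (Prod.norm_mk _ _).trans_le (max_le ?_ ?_)
  · nlinarith
  · calc ‖c.2 * x.1 + c.1 * x.2‖ ≤ ‖c.2‖ * ‖x.1‖ + ‖c.1‖ * ‖x.2‖ := by
          simpa only [norm_mul] using norm_add_le (c.2 * x.1) (c.1 * x.2)
      _ ≤ ‖c‖ * ‖x‖ + ‖c‖ * ‖x‖ := by gcongr
      _ ≤ _ := by nlinarith

theorem companion_sub_right (c x y : ℂ × ℂ) :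
    companion c (x - y) = companion c x - companion c y := by
  ext <;> simp [companion]; ring

theorem norm_companion_sub_left_le (c d x : ℂ × ℂ) :
    ‖companion c x - companion d x‖ ≤ 2 * ‖c - d‖ * ‖x‖ := by
  have h1 := norm_fst_le (c - d)
  have h2 := norm_snd_le (c - d)
  have h3 := norm_fst_le x
  have h4 := norm_snd_le x
  have e : companion c x - companion d x = (0, (c - d).2 * x.1 + (c - d).1 * x.2) := by
    ext <;> simp [companion]; ring
  rw [e, Prod.norm_mk, norm_zero]
  refine max_le (by positivity) ?_
  calc ‖(c - d).2 * x.1 + (c - d).1 * x.2‖ ≤ ‖(c - d).2‖ * ‖x.1‖ + ‖(c - d).1‖ * ‖x.2‖ := by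
        simpa only [norm_mul] using norm_add_le ((c - d).2 * x.1) ((c - d).1 * x.2)
    _ ≤ ‖c - d‖ * ‖x‖ + ‖c - d‖ * ‖x‖ := by gcongr
    _ = _ := by ring

theorem differentiable_companion {c x : ℂ → ℂ × ℂ} (hc : Differentiable ℂ c)
    (hx : Differentiable ℂ x) : Differentiable ℂ fun z => companion (c z) (x z) := by
  unfold companion; fun_prop

theorem continuous_companion : Continuous fun p : (ℂ × ℂ) × (ℂ × ℂ) => companion p.1 p.2 := by
  unfold companion; fun_prop

/-- A primitive of an entire function bounded by `C ‖z‖ ^ n` is bounded by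
`C ‖z‖ ^ (n + 1) / (n + 1)` if it vanishes at the origin. -/
theorem norm_le_of_hasDerivAt_of_norm_le_pow {E : Type*} [NormedAddCommGroup E] [NormedSpace ℂ E]
    {D g : ℂ → E} {C R : ℝ} {n : ℕ} (hD : ∀ z, HasDerivAt D (g z) z) (h0 : D 0 = 0)
    (hg : ∀ z, ‖z‖ ≤ R → ‖g z‖ ≤ C * ‖z‖ ^ n) (z : ℂ) (hz : ‖z‖ ≤ R) :
    ‖D z‖ ≤ C * ‖z‖ ^ (n + 1) / (n + 1) := by
  have hder : ∀ t : ℝ, HasDerivAt (fun t : ℝ => D (t * z)) (z • g (t * z)) t := fun t => by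
    have h1 : HasDerivAt (fun t : ℝ => (t : ℂ) * z) z t := by
      simpa using (Complex.ofRealCLM.hasDerivAt (x := t)).mul_const z
    exact (hD (t * z)).scomp t h1
  have hB : ∀ t : ℝ, HasDerivAt (fun t : ℝ => C * ‖z‖ ^ (n + 1) / (n + 1) * t ^ (n + 1))
      (C * ‖z‖ ^ (n + 1) * t ^ n) t := fun t => by
    refine ((hasDerivAt_pow (n + 1) t).const_mul (C * ‖z‖ ^ (n + 1) / (n + 1))).congr_deriv ?_
    have : (n : ℝ) + 1 ≠ 0 := by positivity
    rw [Nat.add_sub_cancel]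
    push_cast
    field_simp
  -- Along the ray from `0` to `z`, the derivative of `D` is dominated by that of the explicit
  -- boundary function.
  have := image_norm_le_of_norm_deriv_right_le_deriv_boundary (a := 0) (b := 1)
    (fun t _ => (hder t).continuousAt.continuousWithinAt)
    (fun t _ => (hder t).hasDerivWithinAt) (by simp [h0]) hB (fun t ht => by
      have hn : ‖(t : ℂ) * z‖ = t * ‖z‖ := by
        rw [norm_mul, Complex.norm_real, Real.norm_of_nonneg ht.1]
      rw [norm_smul]
      have := hg (t * z) (by rw [hn]; nlinarith [ht.1, ht.2, norm_nonneg z])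
      rw [hn] at this
      calc ‖z‖ * ‖g (t * z)‖ ≤ ‖z‖ * (C * (t * ‖z‖) ^ n) := by gcongr
        _ = _ := by ring) (right_mem_Icc.2 zero_le_one)
  simpa using this

/-- A linear system with entire coefficients has an entire solution with given value at the
origin. -/
theorem exists_entire_solution_zero {c : ℂ → ℂ × ℂ} (hc : Differentiable ℂ c) (x₀ : ℂ × ℂ) :
    ∃ x : ℂ → ℂ × ℂ, x 0 = x₀ ∧ ∀ z, HasDerivAt x (companion (c z) (x z)) z := by
  have prim : ∀ g : {g : ℂ → ℂ × ℂ // Differentiable ℂ g}, ∃ G : {g : ℂ → ℂ × ℂ //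
      Differentiable ℂ g}, G.1 0 = 0 ∧ ∀ z, HasDerivAt G.1 (g.1 z) z := fun g => by
    obtain ⟨G, h0, hG⟩ := g.2.isExactOn_univ.with_val_at 0 0
    exact ⟨⟨G, fun z => (hG z trivial).differentiableAt⟩, h0, fun z => hG z trivial⟩
  choose J hJ0 hJ using prim
  -- The increments of Picard iteration: each is the primitive, vanishing at `0`, of the system
  -- applied to the preceding one. The solution is their sum.
  let d : ℕ → {g : ℂ → ℂ × ℂ // Differentiable ℂ g} := fun n =>
    Nat.rec ⟨fun _ => x₀, differentiable_const _⟩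
      (fun _ g => J ⟨fun z => companion (c z) (g.1 z), differentiable_companion hc g.2⟩) n
  have hd : ∀ n z, HasDerivAt (d (n + 1)).1 (companion (c z) ((d n).1 z)) z := fun n z => hJ _ z
  have hd0 : ∀ n, (d (n + 1)).1 0 = 0 := fun n => hJ0 _
  have bound : ∀ R : ℝ, 0 ≤ R → ∃ M : ℝ, 0 ≤ M ∧
      ∀ n z, ‖z‖ ≤ R → ‖(d n).1 z‖ ≤ ‖x₀‖ * M ^ n / n.factorial * ‖z‖ ^ n := by
    intro R hR
    obtain ⟨B, hB⟩ := (isCompact_closedBall (0 : ℂ) R).exists_bound_of_continuousOn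
      hc.continuous.continuousOn
    have hB0 : 0 ≤ B := (norm_nonneg _).trans (hB 0 (by simpa using hR))
    refine ⟨1 + 2 * B, by positivity, fun n => ?_⟩
    induction n with
    | zero => intro z _; simp [d]
    | succ n ih =>
      intro z hz
      have := norm_le_of_hasDerivAt_of_norm_le_pow (n := n) (R := R)
        (C := ‖x₀‖ * (1 + 2 * B) ^ (n + 1) / n.factorial) (hd n) (hd0 n) (fun w hw => by
          calc _ ≤ (1 + 2 * ‖c w‖) * ‖(d n).1 w‖ := norm_companion_le _ _
            _ ≤ (1 + 2 * B) * (‖x₀‖ * (1 + 2 * B) ^ n / n.factorial * ‖w‖ ^ n) := by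
              gcongr
              · exact hB w (by simpa using hw)
              · exact ih w hw
            _ = _ := by ring) z hz
      refine this.trans_eq ?_
      rw [Nat.factorial_succ]
      push_cast
      field_simp
  let x : ℂ → ℂ × ℂ := fun z => ∑' n, (d n).1 z
  have hconv : TendstoLocallyUniformlyOn (fun N z => ∑ n ∈ Finset.range N, (d n).1 z) x atTop
      univ := by
    rw [tendstoLocallyUniformlyOn_iff_forall_isCompact isOpen_univ]
    intro K _ hK
    obtain ⟨R, hR0, hR⟩ := hK.isBounded.exists_pos_norm_le
    obtain ⟨M, hM0, hM⟩ := bound R hR0.le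
    have hs : Summable fun n : ℕ => ‖x₀‖ * ((M * R) ^ n / n.factorial) :=
      (Real.summable_pow_div_factorial _).mul_left _
    refine tendstoUniformlyOn_tsum_nat hs fun n z hz => (hM n z (hR z hz)).trans ?_
    calc _ ≤ ‖x₀‖ * M ^ n / n.factorial * R ^ n := by
          gcongr; exact hR z hz
      _ = _ := by rw [mul_pow]; ring
  have hdiff : ∀ N, DifferentiableOn ℂ (fun z => ∑ n ∈ Finset.range N, (d n).1 z) univ :=
    fun N => (Differentiable.fun_sum fun n _ => (d n).2).differentiableOn
  have hx : Differentiable ℂ x := differentiableOn_univ.1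
    (hconv.differentiableOn (Eventually.of_forall hdiff) isOpen_univ)
  refine ⟨x, ?_, fun z => ?_⟩
  · change ∑' n, (d n).1 0 = x₀
    rw [tsum_eq_single 0]
    · rfl
    · intro n hn
      obtain ⟨m, rfl⟩ := Nat.exists_eq_succ_of_ne_zero hn
      exact hd0 m
  · have h1 := (hconv.deriv (Eventually.of_forall hdiff) isOpen_univ).tendsto_at (mem_univ z)
    -- Differentiating lowers the index by one and kills the constant term, so the partial sums
    -- satisfy the equation up to a shift.
    have h2 : ∀ N, (deriv ∘ fun N z => ∑ n ∈ Finset.range N, (d n).1 z) (N + 1) z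
        = companion (c z) (∑ n ∈ Finset.range N, (d n).1 z) := fun N => by
      have hder : HasDerivAt (fun z => ∑ n ∈ Finset.range (N + 1), (d n).1 z)
          (∑ n ∈ Finset.range N, companion (c z) ((d n).1 z) + 0) z := by
        simp only [Finset.sum_range_succ']
        exact (HasDerivAt.fun_sum fun n _ => hd n z).add (hasDerivAt_const z x₀)
      have e : ∑ n ∈ Finset.range N, companion (c z) ((d n).1 z)
          = companion (c z) (∑ n ∈ Finset.range N, (d n).1 z) := by
        induction N with
        | zero => ext <;> simp [companion]
        | succ N ih =>
          rw [Finset.sum_range_succ, ih, Finset.sum_range_succ]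
          · ext <;> simp [companion]; ring
          · simp only [Finset.sum_range_succ']
            exact (HasDerivAt.fun_sum fun n _ => hd n z).add (hasDerivAt_const z x₀)
      simpa [e] using hder.deriv
    have h3 := (tendsto_add_atTop_iff_nat 1).2 h1
    simp only [h2] at h3
    have h4 : Tendsto (fun N => companion (c z) (∑ n ∈ Finset.range N, (d n).1 z)) atTop
        (𝓝 (companion (c z) (x z))) :=
      (continuous_companion.tendsto (c z, x z)).comp
        (tendsto_const_nhds.prodMk_nhds (hconv.tendsto_at (mem_univ z)))
    rw [← tendsto_nhds_unique h3 h4]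
    exact (hx z).hasDerivAt

theorem exists_entire_solution {c : ℂ → ℂ × ℂ} (hc : Differentiable ℂ c) (z₀ : ℂ) (x₀ : ℂ × ℂ) :
    ∃ x : ℂ → ℂ × ℂ, x z₀ = x₀ ∧ ∀ z, HasDerivAt x (companion (c z) (x z)) z := by
  obtain ⟨x, h0, hx⟩ := exists_entire_solution_zero (c := fun z => c (z + z₀))
    (hc.comp (differentiable_id.add_const z₀)) x₀
  refine ⟨fun z => x (z - z₀), by simpa using h0, fun z => ?_⟩
  simpa using (hx (z - z₀)).comp_sub_const z z₀

/-- Grönwall's inequality for two linear systems with close coefficients. -/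
theorem norm_sub_le_of_companion {X Y c d : ℝ → ℂ × ℂ} {s : ℂ} {a b M N L η : ℝ}
    (hX : ∀ t ∈ Icc a b, HasDerivAt X (s • companion (c t) (X t)) t)
    (hY : ∀ t ∈ Icc a b, HasDerivAt Y (s • companion (d t) (Y t)) t)
    (hs : ‖s‖ ≤ L) (hd : ∀ t ∈ Icc a b, ‖d t‖ ≤ M) (hcd : ∀ t ∈ Icc a b, ‖d t - c t‖ ≤ η)
    (hN : ∀ t ∈ Icc a b, ‖X t‖ ≤ N) {t : ℝ} (ht : t ∈ Icc a b) :
    ‖Y t - X t‖ ≤ (‖Y a - X a‖ + 2 * L * η * N) *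
      Real.exp ((1 + L * (1 + 2 * M)) * (b - a)) := by
  have hL : 0 ≤ L := (norm_nonneg _).trans hs
  have hM : 0 ≤ M := (norm_nonneg _).trans (hd t ht)
  have hη : 0 ≤ η := (norm_nonneg _).trans (hcd t ht)
  have hN0 : 0 ≤ N := (norm_nonneg _).trans (hN t ht)
  -- The summand `1` gives `K ≥ 1`, so that the factor `1 / K` in Grönwall's bound can be dropped.
  set K := 1 + L * (1 + 2 * M) with hK
  have hK1 : 1 ≤ K := by rw [hK]; nlinarith [mul_nonneg hL (by positivity : 0 ≤ 1 + 2 * M)]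
  have key := norm_le_gronwallBound_of_norm_deriv_right_le (f := fun t => Y t - X t)
    (δ := ‖Y a - X a‖) (K := K) (ε := 2 * L * η * N) (a := a) (b := b)
    (fun t ht => ((hY t ht).sub (hX t ht)).continuousAt.continuousWithinAt)
    (fun t ht => ((hY t (Ico_subset_Icc_self ht)).sub
      (hX t (Ico_subset_Icc_self ht))).hasDerivWithinAt) le_rfl (fun t ht => by
      have ht := Ico_subset_Icc_self ht
      have e : s • companion (d t) (Y t) - s • companion (c t) (X t)
          = s • companion (d t) (Y t - X t)
            + s • (companion (d t) (X t) - companion (c t) (X t)) := by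
        rw [companion_sub_right, ← smul_add, ← smul_sub]; congr 1; abel
      rw [e]
      calc _ ≤ ‖s • companion (d t) (Y t - X t)‖
            + ‖s • (companion (d t) (X t) - companion (c t) (X t))‖ := norm_add_le _ _
        _ ≤ L * ((1 + 2 * M) * ‖Y t - X t‖) + L * (2 * η * N) := by
          rw [norm_smul, norm_smul]
          gcongr
          · exact (norm_companion_le _ _).trans (by gcongr; exact hd t ht)
          · exact (norm_companion_sub_left_le _ _ _).trans
              (by gcongr; exacts [hcd t ht, hN t ht])
        _ ≤ _ := by rw [hK]; nlinarith [norm_nonneg (Y t - X t)]) t ht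
  rw [gronwallBound_of_K_ne_0 (by positivity)] at key
  have hexp : Real.exp (K * (t - a)) ≤ Real.exp (K * (b - a)) := by
    gcongr; exact ht.2
  have h1 : 1 ≤ Real.exp (K * (t - a)) :=
    Real.one_le_exp (mul_nonneg (by positivity) (by linarith [ht.1]))
  have hE : 0 ≤ 2 * L * η * N := by positivity
  refine key.trans ?_
  have h2 : 2 * L * η * N / K * (Real.exp (K * (t - a)) - 1) ≤
      2 * L * η * N * Real.exp (K * (b - a)) := by
    apply mul_le_mul (div_le_self hE hK1) (by linarith) (by linarith) hE
  nlinarith [norm_nonneg (Y a - X a), mul_le_mul_of_nonneg_left hexp (norm_nonneg (Y a - X a))]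

/-- Continuous dependence of the solutions on the coefficients and the initial values, along an
interval. -/
theorem tendstoUniformlyOn_Icc_of_companion {ι : Type*} {l : Filter ι} {a b : ℝ}
    {X c : ℝ → ℂ × ℂ} {Y d : ι → ℝ → ℂ × ℂ} (hab : a ≤ b)
    (hX : ∀ t ∈ Icc a b, HasDerivAt X (companion (c t) (X t)) t)
    (hY : ∀ i, ∀ t ∈ Icc a b, HasDerivAt (Y i) (companion (d i t) (Y i t)) t)
    (hc : ContinuousOn c (Icc a b)) (hdc : TendstoUniformlyOn d c l (Icc a b))
    (h0 : Tendsto (fun i => Y i a) l (𝓝 (X a))) :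
    TendstoUniformlyOn Y X l (Icc a b) := by
  obtain ⟨M, hM⟩ := isCompact_Icc.exists_bound_of_continuousOn hc
  obtain ⟨N, hN⟩ := isCompact_Icc.exists_bound_of_continuousOn
    (f := X) (s := Icc a b) fun t ht => (hX t ht).continuousAt.continuousWithinAt
  have hN0 : 0 ≤ N := (norm_nonneg _).trans (hN a (left_mem_Icc.2 hab))
  set E := Real.exp ((1 + 1 * (1 + 2 * (M + 1))) * (b - a))
  have hE : 0 < E := Real.exp_pos _
  rw [Metric.tendstoUniformlyOn_iff] at hdc ⊢
  intro ε hε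
  -- With `η ≤ 1` the perturbed coefficients are bounded by `M + 1`, the constant built into `E`.
  obtain ⟨η, hη, hη1, hηε⟩ : ∃ η > 0, η ≤ 1 ∧ (η + 2 * 1 * η * N) * E < ε := by
    refine ⟨min 1 (ε / (2 * ((1 + 2 * N) * E))), by positivity, min_le_left _ _, ?_⟩
    have := min_le_right 1 (ε / (2 * ((1 + 2 * N) * E)))
    rw [le_div_iff₀ (by positivity)] at this
    nlinarith
  filter_upwards [hdc η hη, Metric.tendsto_nhds.1 h0 η hη] with i hi h0i t ht
  have hcd : ∀ t ∈ Icc a b, ‖d i t - c t‖ ≤ η := fun t ht => by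
    rw [← dist_eq_norm, dist_comm]; exact (hi t ht).le
  have := norm_sub_le_of_companion (s := 1) (L := 1) (M := M + 1) (by simpa using hX)
    (by simpa using hY i) (by simp)
    (fun t ht => by
      have := norm_add_le (c t) (d i t - c t)
      rw [add_sub_cancel] at this
      linarith [hcd t ht, hM t ht]) hcd hN ht
  rw [dist_comm, dist_eq_norm]
  refine this.trans_lt (lt_of_le_of_lt ?_ hηε)
  rw [dist_eq_norm] at h0i
  gcongr

/-- Continuous dependence of the solutions on the coefficients and the initial values, on a
disc. -/
theorem tendstoUniformlyOn_closedBall_of_companion {ι : Type*} {l : Filter ι} {z₀ : ℂ} {r : ℝ}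
    {x c : ℂ → ℂ × ℂ} {y d : ι → ℂ → ℂ × ℂ} (hr : 0 ≤ r)
    (hx : ∀ z ∈ closedBall z₀ r, HasDerivAt x (companion (c z) (x z)) z)
    (hy : ∀ i, ∀ z ∈ closedBall z₀ r, HasDerivAt (y i) (companion (d i z) (y i z)) z)
    (hc : ContinuousOn c (closedBall z₀ r)) (hdc : TendstoUniformlyOn d c l (closedBall z₀ r))
    (h0 : Tendsto (fun i => y i z₀) l (𝓝 (x z₀))) :
    TendstoUniformlyOn y x l (closedBall z₀ r) := by
  obtain ⟨M, hM⟩ := (isCompact_closedBall z₀ r).exists_bound_of_continuousOn hc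
  obtain ⟨N, hN⟩ := (isCompact_closedBall z₀ r).exists_bound_of_continuousOn
    (f := x) fun t ht => (hx t ht).continuousAt.continuousWithinAt
  have hN0 : 0 ≤ N := (norm_nonneg _).trans (hN z₀ (mem_closedBall_self hr))
  set E := Real.exp ((1 + r * (1 + 2 * (M + 1))) * (1 - 0))
  have hE : 0 < E := Real.exp_pos _
  rw [Metric.tendstoUniformlyOn_iff] at hdc ⊢
  intro ε hε
  obtain ⟨η, hη, hη1, hηε⟩ : ∃ η > 0, η ≤ 1 ∧ (η + 2 * r * η * N) * E < ε := by
    refine ⟨min 1 (ε / (2 * ((1 + 2 * r * N) * E))), by positivity, min_le_left _ _, ?_⟩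
    have := min_le_right 1 (ε / (2 * ((1 + 2 * r * N) * E)))
    rw [le_div_iff₀ (by positivity)] at this
    nlinarith
  filter_upwards [hdc η hη, Metric.tendsto_nhds.1 h0 η hη] with i hi h0i z hz
  have hcd : ∀ w ∈ closedBall z₀ r, ‖d i w - c w‖ ≤ η := fun t ht => by
    rw [← dist_eq_norm, dist_comm]; exact (hi t ht).le
  have hseg : ∀ t ∈ Icc (0 : ℝ) 1, z₀ + t * (z - z₀) ∈ closedBall z₀ r := fun t ht => by
    rw [mem_closedBall, dist_eq_norm] at hz ⊢
    rw [add_sub_cancel_left, norm_mul, Complex.norm_real, Real.norm_of_nonneg ht.1]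
    nlinarith [ht.1, ht.2, norm_nonneg (z - z₀)]
  have hline : ∀ t : ℝ, HasDerivAt (fun t : ℝ => z₀ + (t : ℂ) * (z - z₀)) (z - z₀) t := fun t => by
    simpa using ((Complex.ofRealCLM.hasDerivAt (x := t)).mul_const (z - z₀)).const_add z₀
  -- Grönwall along the radius from `z₀` to `z`; its constants involve `r` but not `z`, hence
  -- uniformity.
  have := norm_sub_le_of_companion (s := z - z₀) (L := r) (M := M + 1) (η := η) (N := N)
    (X := fun t : ℝ => x (z₀ + t * (z - z₀))) (Y := fun t : ℝ => y i (z₀ + t * (z - z₀)))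
    (c := fun t : ℝ => c (z₀ + t * (z - z₀))) (d := fun t : ℝ => d i (z₀ + t * (z - z₀)))
    (a := 0) (b := 1)
    (fun t ht => (hx _ (hseg t ht)).scomp t (hline t))
    (fun t ht => (hy i _ (hseg t ht)).scomp t (hline t)) (by simpa [dist_eq_norm] using hz)
    (fun t ht => by
      have := norm_add_le (c (z₀ + t * (z - z₀)))
        (d i (z₀ + t * (z - z₀)) - c (z₀ + t * (z - z₀)))
      rw [add_sub_cancel] at this
      linarith [hcd _ (hseg t ht), hM _ (hseg t ht)])
    (fun t ht => hcd _ (hseg t ht)) (fun t ht => hN _ (hseg t ht)) (right_mem_Icc.2 zero_le_one)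
  simp only [Complex.ofReal_one, one_mul, add_sub_cancel, Complex.ofReal_zero, zero_mul,
    add_zero] at this
  rw [dist_comm, dist_eq_norm]
  refine this.trans_lt (lt_of_le_of_lt ?_ hηε)
  rw [dist_eq_norm] at h0i
  gcongr

/-- The Wronskian of two states. -/
def wronskian (x y : ℂ × ℂ) : ℂ := x.2 * y.1 - x.1 * y.2

/-- The Wronskian of two solutions has no zeros if it does not vanish at some point. -/
theorem wronskian_ne_zero {c x y : ℂ → ℂ × ℂ} (hc : Differentiable ℂ c)
    (hx : ∀ z, HasDerivAt x (companion (c z) (x z)) z)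
    (hy : ∀ z, HasDerivAt y (companion (c z) (y z)) z) {z₀ : ℂ}
    (h0 : wronskian (x z₀) (y z₀) ≠ 0) (z : ℂ) :
    wronskian (x z) (y z) ≠ 0 := by
  -- Abel's formula: the Wronskian satisfies `W' = c.1 W`, so `W exp (-P)` is constant for a
  -- primitive `P` of `c.1`.
  obtain ⟨P, hP⟩ := (hc.fst).isExactOn_univ
  have hP : ∀ z, HasDerivAt P (c z).1 z := fun z => hP z trivial
  have hder : ∀ z, HasDerivAt (fun z => wronskian (x z) (y z) * Complex.exp (-P z)) 0 z := by
    intro z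
    refine (((((hx z).snd_comp).mul (hy z).fst_comp).sub
      ((hx z).fst_comp.mul (hy z).snd_comp)).mul ((hP z).neg.cexp)).congr_deriv ?_
    simp [companion]
    ring
  have hconst := is_const_of_deriv_eq_zero (fun z => (hder z).differentiableAt)
    (fun z => (hder z).deriv) z z₀
  intro hz
  rw [hz, zero_mul] at hconst
  exact (mul_ne_zero h0 (Complex.exp_ne_zero _)) hconst.symm

/-- The coefficients of the second order equation solved by two functions with states `x`, `y` and
second derivatives `a`, `b`, by Cramer's rule. -/
noncomputable def cramerCoeff (x y : ℂ × ℂ) (a b : ℂ) : ℂ × ℂ :=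
  ((a * y.1 - x.1 * b) / wronskian x y, (x.2 * b - a * y.2) / wronskian x y)

theorem companion_cramerCoeff_left {x y : ℂ × ℂ} (h : wronskian x y ≠ 0) (a b : ℂ) :
    companion (cramerCoeff x y a b) x = (x.2, a) := by
  simp only [companion, cramerCoeff, Prod.mk.injEq, true_and]
  rw [div_mul_eq_mul_div, div_mul_eq_mul_div, ← add_div, div_eq_iff h, wronskian]
  ring

theorem companion_cramerCoeff_right {x y : ℂ × ℂ} (h : wronskian x y ≠ 0) (a b : ℂ) :
    companion (cramerCoeff x y a b) y = (y.2, b) := by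
  simp only [companion, cramerCoeff, Prod.mk.injEq, true_and]
  rw [div_mul_eq_mul_div, div_mul_eq_mul_div, ← add_div, div_eq_iff h, wronskian]
  ring

/-- Independent solutions determine their equation. This is what gives the connecting coefficient
its prescribed end values. -/
theorem cramerCoeff_companion {x y : ℂ × ℂ} (h : wronskian x y ≠ 0) (c : ℂ × ℂ) :
    cramerCoeff x y (companion c x).2 (companion c y).2 = c := by
  ext
  · simp only [companion, cramerCoeff]
    rw [div_eq_iff h, wronskian]
    ring
  · simp only [companion, cramerCoeff]
    rw [div_eq_iff h, wronskian]
    ring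

/-! ### Runge approximation -/

/-- Twice the Wirtinger derivative `∂f/∂z̄`. -/
noncomputable def dbar (f : ℂ → ℂ) (z : ℂ) : ℂ := fderiv ℝ f z 1 + Complex.I * fderiv ℝ f z Complex.I

theorem HasDerivAt.fderiv_real_apply {f : ℂ → ℂ} {f' z : ℂ} (h : HasDerivAt f f' z) (v : ℂ) :
    fderiv ℝ f z v = f' * v := by
  rw [(h.hasFDerivAt.restrictScalars ℝ).fderiv]
  simp [mul_comm]

/-- The holomorphic factor contributes `φ h' (1 + I * I) = 0`. -/
theorem dbar_mul {φ h : ℂ → ℂ} {z : ℂ} (hφ : DifferentiableAt ℝ φ z)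
    (hh : DifferentiableAt ℂ h z) : dbar (fun w => φ w * h w) z = dbar φ z * h z := by
  unfold dbar
  rw [fderiv_fun_mul hφ (hh.restrictScalars ℝ)]
  simp only [_root_.add_apply, _root_.smul_apply, smul_eq_mul,
    hh.hasDerivAt.fderiv_real_apply]
  linear_combination (φ z * deriv h z) * Complex.I_mul_I

theorem dbar_sub {φ ψ : ℂ → ℂ} {z : ℂ} (hφ : DifferentiableAt ℝ φ z)
    (hψ : DifferentiableAt ℝ ψ z) : dbar (fun w => φ w - ψ w) z = dbar φ z - dbar ψ z := by
  unfold dbar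
  rw [fderiv_fun_sub hφ hψ]
  simp only [_root_.sub_apply]
  ring

theorem dbar_comp_sub (φ : ℂ → ℂ) (a z : ℂ) : dbar (fun w => φ (w - a)) z = dbar φ (z - a) := by
  unfold dbar
  rw [fderiv_comp_sub]

theorem dbar_congr {φ ψ : ℂ → ℂ} {z : ℂ} (h : φ =ᶠ[𝓝 z] ψ) : dbar φ z = dbar ψ z := by
  unfold dbar
  rw [h.fderiv_eq]

theorem continuous_dbar {φ : ℂ → ℂ} (hφ : ContDiff ℝ 1 φ) : Continuous (dbar φ) := by
  have := hφ.continuous_fderiv one_ne_zero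
  unfold dbar; fun_prop

theorem tsupport_dbar_subset (φ : ℂ → ℂ) : tsupport (dbar φ) ⊆ tsupport φ := by
  intro z hz
  by_contra h
  rw [notMem_tsupport_iff_eventuallyEq] at h
  refine notMem_tsupport_iff_eventuallyEq.2 ?_ hz
  filter_upwards [h.eventuallyEq_nhds] with w hw
  rw [dbar_congr hw]
  simp [dbar]

theorem HasCompactSupport.dbar {φ : ℂ → ℂ} (hc : HasCompactSupport φ) :
    HasCompactSupport (dbar φ) :=
  hc.mono' ((subset_tsupport _).trans (tsupport_dbar_subset φ))

/-- The product of a continuous scalar function with a function that is continuous on a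
neighbourhood of its support. -/
theorem continuous_smul_of_tsupport_subset {X E : Type*} [TopologicalSpace X]
    [NormedAddCommGroup E] [NormedSpace ℂ E] {u : X → ℂ} {h : X → E} {O : Set X}
    (hu : Continuous u) (hO : IsOpen O) (hh : ContinuousOn h O) (hs : tsupport u ⊆ O) :
    Continuous fun z => u z • h z := by
  refine continuous_iff_continuousAt.2 fun z => ?_
  by_cases hz : z ∈ tsupport u
  · exact hu.continuousAt.smul (hh.continuousAt (hO.mem_nhds (hs hz)))
  · rw [notMem_tsupport_iff_eventuallyEq] at hz
    refine (continuousAt_const (y := (0 : E))).congr ?_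
    filter_upwards [hz] with w hw
    simp [hw]

/-! ### Stokes' theorem for cut-off functions and the Cauchy–Pompeiu formula. -/

theorem integral_dbar_eq_zero {G : ℂ → ℂ} (hG : ContDiff ℝ 1 G) (hc : HasCompactSupport G) :
    ∫ z, dbar G z = 0 := by
  have hcont := hG.continuous_fderiv one_ne_zero
  have hi : ∀ v, Integrable fun z => fderiv ℝ G z v := fun v =>
    Continuous.integrable_of_hasCompactSupport (by fun_prop) (hc.fderiv_apply ℝ v)
  have h0 : ∀ v, ∫ z, fderiv ℝ G z v = 0 := fun v => by
    have := integral_mul_fderiv_eq_neg_fderiv_mul_of_integrable (μ := (volume : Measure ℂ))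
      (f := fun _ : ℂ => (1 : ℂ)) (g := G) (v := v) (by simp) (by simpa using hi v)
      (by simpa using hG.continuous.integrable_of_hasCompactSupport hc)
      (fun _ _ => by fun_prop) (fun z _ => hG.differentiable one_ne_zero z)
    simpa using this
  unfold dbar
  rw [integral_add (hi 1) ((hi _).const_mul _), integral_const_mul, h0, h0]
  simp

/-- The product `φ h` vanishes off the support of `φ`, hence is `C¹` on the whole plane, and `∂/∂z̄`
acts on `φ` alone. This plays the role of Cauchy's theorem, with no contours. -/
theorem integral_dbar_mul_eq_zero {φ h : ℂ → ℂ} {O : Set ℂ} (hφ : ContDiff ℝ 1 φ)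
    (hc : HasCompactSupport φ) (hO : IsOpen O) (hh : DifferentiableOn ℂ h O)
    (hs : tsupport φ ⊆ O) : ∫ z, dbar φ z * h z = 0 := by
  have hG : ContDiff ℝ 1 fun z => φ z * h z := contDiff_iff_contDiffAt.2 fun z => by
    by_cases hz : z ∈ tsupport φ
    · exact hφ.contDiffAt.mul
        ((hh.analyticAt (hO.mem_nhds (hs hz))).contDiffAt.restrict_scalars ℝ)
    · rw [notMem_tsupport_iff_eventuallyEq] at hz
      refine (contDiffAt_const (c := (0 : ℂ))).congr_of_eventuallyEq ?_
      filter_upwards [hz] with w hw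
      simp [hw]
  rw [← integral_dbar_eq_zero hG hc.mul_right]
  congr 1 with z
  by_cases hz : z ∈ tsupport φ
  · exact (dbar_mul (hφ.differentiable one_ne_zero z)
      (hh.differentiableAt (hO.mem_nhds (hs hz)))).symm
  · have h1 : dbar φ z = 0 := image_eq_zero_of_notMem_tsupport fun h => hz (tsupport_dbar_subset φ h)
    rw [notMem_tsupport_iff_eventuallyEq] at hz
    have h2 : (fun w => φ w * h w) =ᶠ[𝓝 z] fun _ => 0 := by
      filter_upwards [hz] with w hw
      simp [hw]
    rw [dbar_congr h2, h1]
    simp [dbar]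

/-- A radial smooth bump function at the origin. -/
noncomputable def radialBump (z : ℂ) : ℂ := (Real.smoothTransition (2 - Complex.normSq z) : ℝ)

theorem contDiff_normSq {n : WithTop ℕ∞} : ContDiff ℝ n fun z : ℂ => Complex.normSq z := by
  simp only [Complex.normSq_apply]
  exact (Complex.reCLM.contDiff.mul Complex.reCLM.contDiff).add
    (Complex.imCLM.contDiff.mul Complex.imCLM.contDiff)

theorem contDiff_radialBump : ContDiff ℝ 1 radialBump :=
  Complex.ofRealCLM.contDiff.comp
    (Real.smoothTransition.contDiff.comp (contDiff_const.sub contDiff_normSq))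

theorem hasCompactSupport_radialBump : HasCompactSupport radialBump := by
  refine HasCompactSupport.intro (isCompact_closedBall (0 : ℂ) 2) fun z hz => ?_
  rw [mem_closedBall, dist_zero_right, not_le] at hz
  have : 2 - Complex.normSq z ≤ 0 := by
    rw [Complex.normSq_eq_norm_sq]; nlinarith
  simp [radialBump, Real.smoothTransition.zero_of_nonpos this]

theorem radialBump_eventuallyEq_one : radialBump =ᶠ[𝓝 0] fun _ => 1 := by
  filter_upwards [ball_mem_nhds (0 : ℂ) one_pos] with z hz
  rw [mem_ball, dist_zero_right] at hz
  have : 1 ≤ 2 - Complex.normSq z := by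
    rw [Complex.normSq_eq_norm_sq]; nlinarith [norm_nonneg z]
  simp [radialBump, Real.smoothTransition.one_of_one_le this]

/-- The factor `z` is the reason for a radial bump: it cancels the Cauchy kernel `z⁻¹` and leaves a
real function of constant sign. -/
theorem dbar_radialBump (z : ℂ) : dbar radialBump z =
    ((-2 * deriv Real.smoothTransition (2 - Complex.normSq z) : ℝ) : ℂ) * z := by
  have h1 : HasDerivAt Real.smoothTransition (deriv Real.smoothTransition (2 - Complex.normSq z))
      (2 - Complex.normSq z) :=
    (Real.smoothTransition.contDiffAt (n := 1)).differentiableAt one_ne_zero |>.hasDerivAt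
  have h2 : HasFDerivAt (fun z : ℂ => 2 - Complex.normSq z)
      (-((z.re • Complex.reCLM + z.re • Complex.reCLM)
        + (z.im • Complex.imCLM + z.im • Complex.imCLM))) z := by
    simp only [Complex.normSq_apply]
    exact ((Complex.reCLM.hasFDerivAt.mul Complex.reCLM.hasFDerivAt).add
      (Complex.imCLM.hasFDerivAt.mul Complex.imCLM.hasFDerivAt)).const_sub 2
  have h3 := Complex.ofRealCLM.hasFDerivAt.comp z (h1.comp_hasFDerivAt z h2)
  have h4 : fderiv ℝ radialBump z = _ := h3.fderiv
  unfold dbar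
  rw [h4]
  apply Complex.ext <;> simp <;> ring

/-- The constant in the Cauchy–Pompeiu formula `∫ dbar φ ζ / (ζ - z) = c φ z`. -/
noncomputable def pompeiuConst : ℂ := ∫ z, dbar radialBump z * z⁻¹

/-- The integrand is minus a nonnegative continuous function. That function is not identically zero,
because the smooth transition climbs from `0` to `1` and so has slope `1` somewhere. The exact value
of the constant is not needed. -/
theorem pompeiuConst_ne_zero : pompeiuConst ≠ 0 := by
  set g : ℂ → ℝ := fun z => 2 * deriv Real.smoothTransition (2 - Complex.normSq z) with hg
  have hgc : Continuous g := by
    have h := (Real.smoothTransition.contDiff (n := 1)).continuous_deriv le_rfl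
    have := Complex.continuous_normSq
    fun_prop
  have e : pompeiuConst = -((∫ z, g z : ℝ) : ℂ) := by
    unfold pompeiuConst
    rw [← integral_complex_ofReal, ← integral_neg]
    refine integral_congr_ae ?_
    have : ∀ᵐ z : ℂ, z ≠ 0 := by simp [ae_iff]
    filter_upwards [this] with z hz
    rw [dbar_radialBump, mul_assoc, mul_inv_cancel₀ hz]
    simp [hg]
  have hnn : 0 ≤ g := fun z => mul_nonneg zero_le_two Real.smoothTransition.monotone.deriv_nonneg
  have hsupp : HasCompactSupport g := by
    refine HasCompactSupport.intro (isCompact_closedBall (0 : ℂ) 2) fun z hz => ?_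
    rw [mem_closedBall, dist_zero_right, not_le] at hz
    have h0 : 2 - Complex.normSq z < 0 := by
      rw [Complex.normSq_eq_norm_sq]; nlinarith
    have : Real.smoothTransition =ᶠ[𝓝 (2 - Complex.normSq z)] fun _ => 0 := by
      filter_upwards [gt_mem_nhds h0] with x hx
      exact Real.smoothTransition.zero_of_nonpos hx.le
    simp [hg, this.deriv_eq]
  obtain ⟨s, hs, hs'⟩ := exists_deriv_eq_slope Real.smoothTransition zero_lt_one
    Real.smoothTransition.continuous.continuousOn
    ((Real.smoothTransition.contDiff (n := 1)).differentiable one_ne_zero).differentiableOn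
  have hne : g (Real.sqrt (2 - s) : ℝ) ≠ 0 := by
    have : Complex.normSq (Real.sqrt (2 - s) : ℝ) = 2 - s := by
      rw [Complex.normSq_ofReal, Real.mul_self_sqrt (by linarith [hs.2])]
    simp only [hg, this, sub_sub_cancel, hs']
    simp
  have := hgc.integral_pos_of_hasCompactSupport_nonneg_nonzero (μ := volume) hsupp hnn hne
  rw [e, neg_ne_zero]
  exact_mod_cast this.ne'

theorem tsupport_dbar_subset_compl {φ : ℂ → ℂ} {s : Set ℂ} (h : ∀ z ∈ s, φ =ᶠ[𝓝 z] fun _ => 1) :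
    tsupport (dbar φ) ⊆ sᶜ := by
  intro z hz hzs
  refine notMem_tsupport_iff_eventuallyEq.2 ?_ hz
  filter_upwards [(h z hzs).eventuallyEq_nhds] with w hw
  rw [dbar_congr hw]
  simp [dbar]

theorem continuousOn_inv_sub (z : ℂ) : ContinuousOn (fun w : ℂ => (w - z)⁻¹) {z}ᶜ :=
  (by fun_prop : Continuous fun w : ℂ => w - z).continuousOn.inv₀ fun _ hw => sub_ne_zero.2 hw

/-- The integral does not depend on the cutoff: two cutoffs equal to `1` near `z` differ by a
function supported where the Cauchy kernel is holomorphic. So `φ` may be replaced by the translated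
radial bump. -/
theorem integral_dbar_mul_inv_sub {φ : ℂ → ℂ} {z : ℂ} (hφ : ContDiff ℝ 1 φ)
    (hc : HasCompactSupport φ) (h1 : φ =ᶠ[𝓝 z] fun _ => 1) :
    ∫ w, dbar φ w * (w - z)⁻¹ = pompeiuConst := by
  set ψ : ℂ → ℂ := fun w => radialBump (w - z) with hψ_def
  have hψ : ContDiff ℝ 1 ψ := contDiff_radialBump.comp (contDiff_id.sub contDiff_const)
  have hψc : HasCompactSupport ψ :=
    hasCompactSupport_radialBump.comp_homeomorph (Homeomorph.subRight z)
  have hψ1 : ψ =ᶠ[𝓝 z] fun _ => 1 := by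
    have : Tendsto (fun w : ℂ => w - z) (𝓝 z) (𝓝 0) := by
      simpa using (continuous_sub_right z).tendsto z
    exact this.eventually radialBump_eventuallyEq_one
  have hi : ∀ {χ : ℂ → ℂ}, ContDiff ℝ 1 χ → HasCompactSupport χ → χ =ᶠ[𝓝 z] (fun _ => 1) →
      Integrable fun w => dbar χ w * (w - z)⁻¹ := fun {χ} h2 h3 h4 => by
    refine Continuous.integrable_of_hasCompactSupport ?_ ?_
    · simpa only [smul_eq_mul] using continuous_smul_of_tsupport_subset (continuous_dbar h2)
        isOpen_compl_singleton (continuousOn_inv_sub z)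
        (tsupport_dbar_subset_compl (s := {z}) (by simpa using h4))
    · exact h3.dbar.mul_right
  have key : ∫ w, dbar (fun w => φ w - ψ w) w * (w - z)⁻¹ = 0 := by
    refine integral_dbar_mul_eq_zero (hφ.sub hψ) (hc.sub hψc) (O := {z}ᶜ) isOpen_compl_singleton
      ((differentiable_id.sub_const z).differentiableOn.inv fun w hw => sub_ne_zero.2 hw) ?_
    intro w hw hwz
    rw [mem_singleton_iff] at hwz
    subst hwz
    refine notMem_tsupport_iff_eventuallyEq.2 ?_ hw
    filter_upwards [h1, hψ1] with u h2 h3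
    simp [h2, h3]
  have e : (fun w => dbar (fun w => φ w - ψ w) w * (w - z)⁻¹) =
      fun w => dbar φ w * (w - z)⁻¹ - dbar ψ w * (w - z)⁻¹ := by
    ext w
    rw [dbar_sub (hφ.differentiable one_ne_zero w) (hψ.differentiable one_ne_zero w), sub_mul]
  rw [e, integral_sub (hi hφ hc h1) (hi hψ hψc hψ1), sub_eq_zero] at key
  rw [key]
  have : (fun w => dbar ψ w * (w - z)⁻¹) = fun w => (fun w => dbar radialBump w * w⁻¹) (w - z) := by
    ext w
    rw [hψ_def, dbar_comp_sub]
  rw [this, integral_sub_right_eq_self (fun w => dbar radialBump w * w⁻¹)]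
  rfl

/-- The Cauchy–Pompeiu formula for a holomorphic function cut off by a smooth function. -/
theorem integral_dbar_mul_mul_inv_sub {φ f : ℂ → ℂ} {z : ℂ} {O : Set ℂ} (hφ : ContDiff ℝ 1 φ)
    (hc : HasCompactSupport φ) (h1 : φ =ᶠ[𝓝 z] fun _ => 1) (hO : IsOpen O)
    (hf : DifferentiableOn ℂ f O) (hs : tsupport φ ⊆ O) :
    ∫ w, dbar φ w * f w * (w - z)⁻¹ = pompeiuConst * f z := by
  have hzO : z ∈ O := hs (subset_tsupport _ (by simp [h1.eq_of_nhds]))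
  have hz : O ∈ 𝓝 z := hO.mem_nhds hzO
  -- The difference quotient of `f` at `z` has a removable singularity there, which reduces the
  -- formula to constant `f`.
  have key := integral_dbar_mul_eq_zero hφ hc hO ((Complex.differentiableOn_dslope hz).2 hf) hs
  have hsupp := tsupport_dbar_subset_compl (s := {z}) (φ := φ) (by simpa using h1)
  have hdz : dbar φ z = 0 := image_eq_zero_of_notMem_tsupport fun h => hsupp h rfl
  have e : (fun w => dbar φ w * dslope f z w) =
      fun w => dbar φ w * f w * (w - z)⁻¹ - f z * (dbar φ w * (w - z)⁻¹) := by
    ext w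
    by_cases hw : w = z
    · simp [hw, hdz]
    · rw [dslope_of_ne _ hw, slope_def_field, div_eq_mul_inv]
      ring
  have hi1 : Integrable fun w => dbar φ w * f w * (w - z)⁻¹ := by
    refine Continuous.integrable_of_hasCompactSupport ?_ hc.dbar.mul_right.mul_right
    simpa only [smul_eq_mul, mul_assoc] using continuous_smul_of_tsupport_subset
      (h := fun w => f w * (w - z)⁻¹) (continuous_dbar hφ)
      (hO.inter isOpen_compl_singleton) ((hf.continuousOn.mono inter_subset_left).mul
        ((continuousOn_inv_sub z).mono inter_subset_right))
      (subset_inter ((tsupport_dbar_subset φ).trans hs) hsupp)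
  have hi2 : Integrable fun w => dbar φ w * (w - z)⁻¹ := by
    refine Continuous.integrable_of_hasCompactSupport ?_ hc.dbar.mul_right
    simpa only [smul_eq_mul] using continuous_smul_of_tsupport_subset (continuous_dbar hφ)
        isOpen_compl_singleton (continuousOn_inv_sub z) hsupp
  rw [e, integral_sub hi1 (hi2.const_mul _), integral_const_mul,
    integral_dbar_mul_inv_sub hφ hc h1, sub_eq_zero] at key
  rw [key, mul_comm]

/-- The uniform closure of the polynomials in `C(K, ℂ)`. -/
noncomputable abbrev polynomialClosure (K : Set ℂ) [CompactSpace K] : Subalgebra ℂ C(K, ℂ) :=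
  (polynomialFunctions K).topologicalClosure

instance (K : Set ℂ) [CompactSpace K] :
    IsClosed ((polynomialClosure K : Subalgebra ℂ C(K, ℂ)) : Set C(K, ℂ)) :=
  Subalgebra.isClosed_topologicalClosure _

instance (K : Set ℂ) [CompactSpace K] : CompleteSpace (polynomialClosure K) :=
  IsClosed.completeSpace_coe (s := ((polynomialClosure K : Subalgebra ℂ C(K, ℂ)) : Set C(K, ℂ)))

/-- The coordinate function as an element of the closure of the polynomials. -/
noncomputable def polynomialClosure.X (K : Set ℂ) [CompactSpace K] : polynomialClosure K :=
  ⟨Polynomial.toContinuousMapOn Polynomial.X K,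
    Subalgebra.le_topologicalClosure _ ⟨Polynomial.X, by simp⟩⟩

/-- The polynomially convex hull of `K`, as the spectrum of the coordinate function. -/
noncomputable def polynomialHull (K : Set ℂ) [CompactSpace K] : Set ℂ :=
  spectrum ℂ (polynomialClosure.X K)

theorem isCompact_polynomialHull (K : Set ℂ) [CompactSpace K] : IsCompact (polynomialHull K) :=
  spectrum.isCompact _

theorem spectrum_coe_polynomialClosure_X (K : Set ℂ) [CompactSpace K] :
    spectrum ℂ (polynomialClosure.X K : C(K, ℂ)) = K := by
  rw [ContinuousMap.spectrum_eq_range]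
  ext z
  simp [polynomialClosure.X]

theorem subset_polynomialHull (K : Set ℂ) [CompactSpace K] : K ⊆ polynomialHull K := by
  have := spectrum.subset_subalgebra (R := ℂ) (polynomialClosure.X K)
  rwa [spectrum_coe_polynomialClosure_X] at this

/-- Passing to a closed subalgebra enlarges a spectrum only by filling in holes, so no new boundary
points arise. -/
theorem frontier_polynomialHull_subset (K : Set ℂ) [CompactSpace K] :
    frontier (polynomialHull K) ⊆ K := by
  have := Subalgebra.frontier_spectrum (𝕜 := ℂ) (polynomialClosure K) (polynomialClosure.X K)
  rwa [spectrum_coe_polynomialClosure_X] at this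

/-- A continuous function without zeros on the plane cannot agree with `z ↦ z - w` near
infinity. -/
theorem not_eq_sub_of_continuous_of_ne_zero {F : ℂ → ℂ} {w : ℂ} {r : ℝ} (hF : Continuous F)
    (h0 : ∀ z, F z ≠ 0) (hr : 0 < r) : ¬ ∀ z, ‖z - w‖ = r → F z = z - w := by
  intro h
  have hsc : IsSimplyConnected (univ : Set ℂ) := by
    have := convex_univ.contractibleSpace (univ_nonempty (α := ℂ))
    exact (inferInstance : SimplyConnectedSpace (univ : Set ℂ))
  obtain ⟨G, hG, hGF⟩ := Complex.exists_continuousOn_eqOn_exp_comp hsc isOpen_univ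
    hF.continuousOn (by simpa using h0)
  rw [continuousOn_univ] at hG
  -- Here `G` is a continuous logarithm of `F`. On the circle `exp ∘ g` is the constant `r`, so `g`
  -- is constant; but it drops by `2πi` over one turn.
  set g : ℝ → ℂ := fun θ => G (w + r * Complex.exp (θ * Complex.I)) - θ * Complex.I with hg
  have hgc : Continuous g := by fun_prop
  have hexp : ∀ θ, Complex.exp (g θ) = r := fun θ => by
    have h1 : Complex.exp (G (w + r * Complex.exp (θ * Complex.I))) =
        F (w + r * Complex.exp (θ * Complex.I)) := hGF (mem_univ _)
    rw [hg]
    simp only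
    rw [Complex.exp_sub, h1, h _ (by simp [Complex.norm_exp_ofReal_mul_I, hr.le])]
    field_simp
    ring
  have key : g = fun _ => g 0 := Complex.isCoveringMap_exp.eq_of_comp_eq hgc continuous_const
    (by ext θ; simp [hexp]) 0 rfl
  have h2 := congrFun key (2 * Real.pi)
  simp [hg, Complex.exp_two_pi_mul_I] at h2

/-- The polynomially convex hull of a compact subset of a simply connected open set is contained
in that set. -/
theorem polynomialHull_subset {K Ω : Set ℂ} [CompactSpace K] (hΩ : IsOpen Ω)
    (hsc : IsSimplyConnected Ω) (hK : K ⊆ Ω) : polynomialHull K ⊆ Ω := by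
  intro w hw
  by_contra hwΩ
  -- For `w` in the hull but outside `Ω`, take a logarithm of `z - w` on `Ω` and extend its
  -- restriction to `K` by Tietze. Its exponential on the hull pastes with `z - w` off the hull,
  -- since the frontier lies in `K`, into a zero-free function that cannot exist.
  obtain ⟨H, hH, hHexp⟩ := Complex.exists_continuousOn_eqOn_exp_comp hsc hΩ (g := fun z => z - w)
    (by fun_prop) (by rintro ⟨z, hz, hzw⟩; exact hwΩ (sub_eq_zero.1 hzw ▸ hz))
  have hKc : IsClosed K := (isCompact_iff_compactSpace.2 ‹_›).isClosed
  obtain ⟨H', hH'⟩ := ContinuousMap.exists_restrict_eq (Y := ℂ) hKc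
    ⟨K.domRestrict H, continuousOn_iff_continuous_domRestrict.1 (hH.mono hK)⟩
  have hHK : ∀ z ∈ K, Complex.exp (H' z) = z - w := fun z hz => by
    have : H' z = H z := by simpa using DFunLike.congr_fun hH' ⟨z, hz⟩
    rw [this]
    exact hHexp (hK hz)
  classical
  set F : ℂ → ℂ := (polynomialHull K).piecewise (fun z => Complex.exp (H' z)) (fun z => z - w)
  have hF : Continuous F := Continuous.piecewise
    (fun z hz => hHK z (frontier_polynomialHull_subset K hz)) (by fun_prop) (by fun_prop)
  have hF0 : ∀ z, F z ≠ 0 := fun z => by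
    by_cases hz : z ∈ polynomialHull K
    · simp [F, hz]
    · simp only [F, hz, not_false_eq_true, piecewise_eq_of_notMem]
      exact sub_ne_zero.2 fun h => hz (h ▸ hw)
  obtain ⟨r, hr0, hr⟩ := (isCompact_polynomialHull K).isBounded.exists_pos_norm_le
  refine not_eq_sub_of_continuous_of_ne_zero hF hF0 (w := w) (r := 2 * r + 1) (by linarith)
    fun z hz => ?_
  have : z ∉ polynomialHull K := fun h => by
    have := norm_sub_le z w
    linarith [hr z h, hr w hw]
  simp [F, this]

/-- A smooth cutoff function for a compact set in an open set. -/
theorem exists_smooth_cutoff {C O : Set ℂ} (hC : IsCompact C) (hO : IsOpen O) (hCO : C ⊆ O) :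
    ∃ ψ : ℂ → ℂ, ContDiff ℝ 1 ψ ∧ HasCompactSupport ψ ∧ tsupport ψ ⊆ O ∧
      ∀ z ∈ C, ψ =ᶠ[𝓝 z] fun _ => 1 := by
  obtain ⟨L, hLc, hKL, hLO⟩ := exists_compact_between hC hO hCO
  obtain ⟨φ, hφ1, hφ0, -⟩ := exists_contMDiffMap_one_nhds_of_subset_interior (n := 1)
    (modelWithCornersSelf ℝ ℂ) hC.isClosed hKL
  have hφ : ContDiff ℝ 1 φ := contMDiff_iff_contDiff.1 φ.contMDiff
  have hL : tsupport (fun z => (φ z : ℂ)) ⊆ L := closure_minimal (fun z hz => by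
    by_contra h
    exact hz (by simp [hφ0 z h])) hLc.isClosed
  refine ⟨fun z => (φ z : ℂ), Complex.ofRealCLM.contDiff.comp hφ,
    hLc.of_isClosed_subset (isClosed_tsupport _) hL, hL.trans hLO, fun z hz => ?_⟩
  filter_upwards [hφ1.filter_mono (nhds_le_nhdsSet hz)] with w hw
  simp [hw]

/-- Holomorphic functional calculus, tested on characters: if `f` is holomorphic near the spectrum
of `a`, some element of the Banach algebra has the value `f (χ a)` at every character `χ`. -/
theorem exists_forall_character_eq {A : Type*} [NormedRing A] [NormedAlgebra ℂ A]
    [CompleteSpace A] (a : A) {f : ℂ → ℂ} (hf : AnalyticOnNhd ℂ f (spectrum ℂ a)) :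
    ∃ b : A, ∀ χ : A →L[ℂ] ℂ, (∀ x y, χ (x * y) = χ x * χ y) → χ 1 = 1 → χ b = f (χ a) := by
  obtain ⟨O, hO, hfO, hf⟩ : ∃ O, IsOpen O ∧ DifferentiableOn ℂ f O ∧ spectrum ℂ a ⊆ O :=
    ⟨{z | AnalyticAt ℂ f z}, isOpen_analyticAt ℂ f,
      fun z hz => hz.differentiableAt.differentiableWithinAt, hf⟩
  have hcomp : IsCompact (spectrum ℂ a) := spectrum.isCompact a
  obtain ⟨ψ, hψ, hψc, hψO, hψ1⟩ := exists_smooth_cutoff hcomp hO hf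
  -- The Cauchy–Pompeiu integrand with the resolvent in place of the Cauchy kernel; a character
  -- turns one into the other.
  let F : ℂ → A := fun w => dbar ψ w • (f w • resolvent a w)
  have hFc : Continuous F := continuous_smul_of_tsupport_subset
    (O := O ∩ (spectrum ℂ a)ᶜ) (continuous_dbar hψ) (hO.inter hcomp.isClosed.isOpen_compl)
    ((hfO.continuousOn.mono inter_subset_left).smul fun w hw =>
      (spectrum.hasDerivAt_resolvent_const_left
        (spectrum.mem_resolventSet_iff.2 (spectrum.notMem_iff.1 hw.2))).continuousAt.continuousWithinAt)
    (subset_inter ((tsupport_dbar_subset ψ).trans hψO)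
      (tsupport_dbar_subset_compl hψ1))
  have hFi : Integrable F := hFc.integrable_of_hasCompactSupport hψc.dbar.smul_right
  refine ⟨pompeiuConst⁻¹ • ∫ w, F w, fun χ hmul hone => ?_⟩
  have hinv : ∀ w ∉ spectrum ℂ a, χ (resolvent a w) * (w - χ a) = 1 := fun w hw => by
    have h0 : resolvent a w * (algebraMap ℂ A w - a) = 1 :=
      Ring.inverse_mul_cancel _ (spectrum.notMem_iff.1 hw)
    have h := congrArg χ h0
    rwa [hmul, hone, map_sub, Algebra.algebraMap_eq_smul_one, map_smul, hone, smul_eq_mul,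
      mul_one] at h
  have hχ : χ a ∈ spectrum ℂ a := by
    by_contra h
    simpa using hinv _ h
  rw [map_smul, ← χ.integral_comp_comm hFi, smul_eq_mul, inv_mul_eq_iff_eq_mul₀ pompeiuConst_ne_zero,
    ← integral_dbar_mul_mul_inv_sub hψ hψc (hψ1 _ hχ) hO hfO hψO]
  congr 1 with w
  by_cases hw : w ∈ spectrum ℂ a
  · have : dbar ψ w = 0 := image_eq_zero_of_notMem_tsupport fun h =>
      tsupport_dbar_subset_compl hψ1 h hw
    simp [F, this]
  · simp only [F, map_smul, eq_inv_of_mul_eq_one_left (hinv w hw), smul_eq_mul]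
    ring

/-- **Runge's theorem**: a function that is holomorphic near the polynomially convex hull of a
compact set `K` is a uniform limit of polynomials on `K`. -/
theorem exists_polynomial_approx {K : Set ℂ} [CompactSpace K] {f : ℂ → ℂ}
    (hf : AnalyticOnNhd ℂ f (polynomialHull K)) {ε : ℝ} (hε : 0 < ε) :
    ∃ p : Polynomial ℂ, ∀ z ∈ K, ‖p.eval z - f z‖ < ε := by
  obtain ⟨b, hb⟩ := exists_forall_character_eq (polynomialClosure.X K) hf
  have hb' : (b : C(K, ℂ)) ∈
      closure ((polynomialFunctions K : Subalgebra ℂ C(K, ℂ)) : Set C(K, ℂ)) := b.2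
  obtain ⟨q, ⟨p, -, rfl⟩, hq⟩ := Metric.mem_closure_iff.1 hb' ε hε
  refine ⟨p, fun z hz => ?_⟩
  -- Evaluation at a point of `K` is a character sending the coordinate to that point; hence `b = f`
  -- on `K`.
  have h1 := hb ((ContinuousMap.evalCLM ℂ (⟨z, hz⟩ : K)).comp
    (polynomialClosure K).toSubmodule.subtypeL) (fun x y => rfl) rfl
  have h2 : b.1 ⟨z, hz⟩ = f z := by
    refine h1.trans ?_
    congr 1
    change (Polynomial.toContinuousMapOn Polynomial.X K) ⟨z, hz⟩ = z
    simp
  rw [dist_comm] at hq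
  have h3 := (ContinuousMap.dist_apply_le_dist (⟨z, hz⟩ : K)).trans_lt hq
  rw [← h2, ← dist_eq_norm]
  simpa using h3

/-! ### Homogeneous coordinates on the sphere -/

namespace RiemannSphere

/-- A finite point of the sphere. -/
def ofComplex (z : ℂ) : RiemannSphere := (some z : Option ℂ)

open Classical in
/-- The point of the sphere with homogeneous coordinates `v`. -/
noncomputable def proj (v : ℂ × ℂ) : RiemannSphere := if v.2 = 0 then infty else ofComplex (v.1 / v.2)

theorem ofComplex_ne_infty (z : ℂ) : ofComplex z ≠ infty := Option.some_ne_none z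

theorem ofComplex_toComplex {p : RiemannSphere} (hp : p ≠ infty) : ofComplex p.toComplex = p := by
  rcases p with _ | z
  · exact absurd rfl hp
  · rfl

theorem proj_eq_infty_iff {v : ℂ × ℂ} : proj v = infty ↔ v.2 = 0 := by
  unfold proj
  split_ifs with h <;> simp [h, ofComplex_ne_infty]

theorem toComplex_proj (v : ℂ × ℂ) : (proj v).toComplex = v.1 / v.2 := by
  unfold proj
  split_ifs with h
  · simp [h]; rfl
  · rfl

/-- The chordal distance in homogeneous coordinates. -/
theorem dist_proj {v w : ℂ × ℂ} (hv : v ≠ 0) (hw : w ≠ 0) : dist (proj v) (proj w) =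
    ‖v.1 * w.2 - v.2 * w.1‖ / (√(‖v.1‖ ^ 2 + ‖v.2‖ ^ 2) * √(‖w.1‖ ^ 2 + ‖w.2‖ ^ 2)) := by
  obtain ⟨a, b⟩ := v
  obtain ⟨c, d⟩ := w
  have sq : ∀ {a b : ℂ}, b ≠ 0 → √(1 + ‖a / b‖ ^ 2) = √(‖a‖ ^ 2 + ‖b‖ ^ 2) / ‖b‖ := fun {a b} hb => by
    have hb' : 0 < ‖b‖ := norm_pos_iff.2 hb
    rw [← Real.sqrt_sq hb'.le, ← Real.sqrt_div (by positivity), Real.sqrt_sq hb'.le]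
    congr 1
    rw [norm_div]
    field_simp
    ring
  have sqpos : ∀ {a b : ℂ}, b ≠ 0 → √(‖a‖ ^ 2 + ‖b‖ ^ 2) ≠ 0 := fun {a b} hb => by
    have hb' : 0 < ‖b‖ := norm_pos_iff.2 hb
    positivity
  change chordal _ _ = _
  by_cases hb : b = 0
  · have ha : a ≠ 0 := fun ha => hv (by simp [ha, hb])
    have ha' : ‖a‖ ≠ 0 := norm_ne_zero_iff.2 ha
    by_cases hd : d = 0
    · simp only [proj, hb, hd]
      simp [chordal, infty]
    · have hd' : ‖d‖ ≠ 0 := norm_ne_zero_iff.2 hd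
      have := sqpos (a := c) hd
      simp only [proj, hb, hd, if_true, if_false]
      simp only [chordal, infty, ofComplex, sq hd]
      simp
      field_simp
  · have hb' : ‖b‖ ≠ 0 := norm_ne_zero_iff.2 hb
    have := sqpos (a := a) hb
    by_cases hd : d = 0
    · have hc : c ≠ 0 := fun hc => hw (by simp [hc, hd])
      have hc' : ‖c‖ ≠ 0 := norm_ne_zero_iff.2 hc
      simp only [proj, hb, hd, if_true, if_false]
      simp only [chordal, infty, ofComplex, sq hb]
      simp
      field_simp
    · have hd' : ‖d‖ ≠ 0 := norm_ne_zero_iff.2 hd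
      have := sqpos (a := c) hd
      simp only [proj, hb, hd, if_false]
      simp only [chordal, ofComplex, sq hb, sq hd]
      have e : a / b - c / d = (a * d - b * c) / (b * d) := by field_simp
      rw [e, norm_div, norm_mul]
      field_simp

theorem norm_le_sqrt (v : ℂ × ℂ) : ‖v‖ ≤ √(‖v.1‖ ^ 2 + ‖v.2‖ ^ 2) :=
  max_le (Real.le_sqrt_of_sq_le (by nlinarith [sq_nonneg ‖v.2‖]))
    (Real.le_sqrt_of_sq_le (by nlinarith [sq_nonneg ‖v.1‖]))

/-- The determinant of `v` and `w` equals that of `v - w` and `w`, and the factor `‖w‖` cancels.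
Only the limit vector `v` has to be bounded away from zero. -/
theorem dist_proj_le {v w : ℂ × ℂ} (hv : v ≠ 0) (hw : w ≠ 0) :
    dist (proj v) (proj w) ≤ 2 * ‖v - w‖ / ‖v‖ := by
  have hv' : 0 < ‖v‖ := norm_pos_iff.2 hv
  have hw' : 0 < ‖w‖ := norm_pos_iff.2 hw
  have h1 : ‖v.1 * w.2 - v.2 * w.1‖ ≤ 2 * ‖v - w‖ * ‖w‖ := by
    have e : v.1 * w.2 - v.2 * w.1 = (v - w).1 * w.2 - (v - w).2 * w.1 := by simp; ring
    rw [e]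
    calc _ ≤ ‖(v - w).1‖ * ‖w.2‖ + ‖(v - w).2‖ * ‖w.1‖ := by
          simpa only [norm_mul] using norm_sub_le ((v - w).1 * w.2) ((v - w).2 * w.1)
      _ ≤ ‖v - w‖ * ‖w‖ + ‖v - w‖ * ‖w‖ := by
        gcongr <;> first | exact norm_fst_le _ | exact norm_snd_le _
      _ = _ := by ring
  rw [dist_proj hv hw]
  calc _ ≤ 2 * ‖v - w‖ * ‖w‖ / (‖v‖ * ‖w‖) := by
        gcongr <;> exact norm_le_sqrt _
    _ = _ := by field_simp

end RiemannSphere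

open RiemannSphere

/-! ### Locally univalent functions as quotients of solutions -/

theorem finitePart_of_mem {Ω : Opens ℂ} (f : Ω → RiemannSphere) {z : ℂ} (hz : z ∈ Ω) :
    finitePart f z = (f ⟨z, hz⟩).toComplex := by simp [finitePart, hz]

theorem fst_ne_zero_of_wronskian {x y : ℂ × ℂ} (h : wronskian x y ≠ 0) : ((x.1, y.1) : ℂ × ℂ) ≠ 0 := by
  intro h0
  simp only [Prod.mk_eq_zero] at h0
  simp [wronskian, h0.1, h0.2] at h

/-- The quotient of two solutions with nonvanishing Wronskian is locally univalent. -/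
theorem exists_locallyUnivalent_of_companion {c x y : ℂ → ℂ × ℂ}
    (hx : ∀ z, HasDerivAt x (companion (c z) (x z)) z)
    (hy : ∀ z, HasDerivAt y (companion (c z) (y z)) z)
    (hw : ∀ z, wronskian (x z) (y z) ≠ 0) :
    ∃ f : LocallyUnivalentFunction ⊤, ∀ z, f.1 z = proj ((x z).1, (y z).1) := by
  have hxd : ∀ z, HasDerivAt (fun z => (x z).1) (x z).2 z := fun z => (hx z).fst_comp
  have hyd : ∀ z, HasDerivAt (fun z => (y z).1) (y z).2 z := fun z => (hy z).fst_comp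
  have hxa : ∀ z, AnalyticAt ℂ (fun z => (x z).1) z := fun z =>
    Differentiable.analyticAt (fun z => (hxd z).differentiableAt) z
  have hya : ∀ z, AnalyticAt ℂ (fun z => (y z).1) z := fun z =>
    Differentiable.analyticAt (fun z => (hyd z).differentiableAt) z
  let F : (⊤ : Opens ℂ) → RiemannSphere := fun z => proj ((x z).1, (y z).1)
  have hF : finitePart F = fun z => (x z).1 / (y z).1 := by
    ext z
    rw [finitePart_of_mem F (show z ∈ (⊤ : Opens ℂ) from trivial), toComplex_proj]
  have hinf : ∀ z, F z = infty ↔ (y z).1 = 0 := fun z => proj_eq_infty_iff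
  -- At a zero of the denominator the Wronskian reduces to minus the numerator times the derivative
  -- of the denominator, so the zero is simple and does not cancel.
  have horder : ∀ z, (y z).1 = 0 → meromorphicOrderAt (finitePart F) z = -1 := fun z hz => by
    have hwz := hw z
    simp only [wronskian, hz, mul_zero, zero_sub, neg_ne_zero, mul_ne_zero_iff] at hwz
    have h1 : meromorphicOrderAt (fun z => (x z).1) z = 0 := by
      rw [(hxa z).meromorphicOrderAt_eq, (hxa z).analyticOrderAt_eq_zero.2 hwz.1]
      rfl
    have h2 : meromorphicOrderAt (fun z => (y z).1) z = 1 := by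
      rw [(hya z).meromorphicOrderAt_eq, (hya z).analyticOrderAt_eq_one_of_zero_deriv_ne_zero hz
        (by rw [(hyd z).deriv]; exact hwz.2)]
      rfl
    rw [hF, show (fun z => (x z).1 / (y z).1) = (fun z => (x z).1) / fun z => (y z).1 from rfl,
      meromorphicOrderAt_div (hxa z).meromorphicAt (hya z).meromorphicAt, h1, h2]
    rfl
  refine ⟨⟨⟨F, fun z hz => ?_, fun z hz => ?_⟩, fun z hz => ?_, fun z hz => ?_⟩, fun z => rfl⟩
  · rw [hF]
    exact (hxa z).div (hya z) (fun h => hz ((hinf z).2 h))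
  · rw [horder z ((hinf z).1 hz), hF]
    exact ⟨(hxa z).meromorphicAt.div (hya z).meromorphicAt, by decide⟩
  · exact (horder z ((hinf z).1 hz)).ge
  · have h0 : (y z).1 ≠ 0 := fun h => hz ((hinf z).2 h)
    change deriv (finitePart F) z ≠ 0
    rw [hF, ((hxd z).fun_div (hyd z) h0).deriv]
    exact div_ne_zero (hw z) (pow_ne_zero 2 h0)

/-- Density for the topology of locally uniform convergence. -/
theorem dense_locallyUnivalentFunction {Ω : Opens ℂ} {S : Set (LocallyUnivalentFunction Ω)}
    (h : ∀ (g : LocallyUnivalentFunction Ω) (K : Set ℂ), IsCompact K → K ⊆ Ω → ∀ ε > 0,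
      ∃ f ∈ S, ∀ z : Ω, (z : ℂ) ∈ K → dist (f.1 z) (g.1 z) < ε) : Dense S := by
  intro g
  have hb : (𝓝 (UniformOnFun.ofFun {K : Set Ω | IsCompact K} g.1.toFun)).HasBasis _ _ :=
    UniformOnFun.hasBasis_nhds_of_basis Ω RiemannSphere {K : Set Ω | IsCompact K}
      (UniformOnFun.ofFun {K : Set Ω | IsCompact K} g.1.toFun) ⟨∅, isCompact_empty⟩
      (directedOn_of_sup_mem fun _ _ h1 h2 => h1.union h2) uniformity_basis_dist
  refine mem_closure_iff_nhds.2 fun t ht => ?_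
  rw [nhds_subtype_eq_comap, nhds_induced] at ht
  obtain ⟨⟨K, ε⟩, ⟨hK, hε⟩, hsub⟩ := ((hb.comap _).comap _).mem_iff.1 ht
  obtain ⟨f, hfS, hf⟩ := h g (Subtype.val '' K) (hK.image continuous_subtype_val)
    (by rintro _ ⟨z, -, rfl⟩; exact z.2) ε hε
  refine ⟨f, hsub fun z hz => ?_, hfS⟩
  exact hf z ⟨z, hz, rfl⟩

/-! ### Approximation of locally univalent functions on simply connected domains -/

/-- A compact subset of a path connected open set has a connected open neighbourhood that is
contained in a compact subset. -/
theorem exists_isPreconnected_between {K Ω : Set ℂ} (hΩ : IsOpen Ω) (hc : IsPathConnected Ω)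
    (hK : IsCompact K) (hKΩ : K ⊆ Ω) :
    ∃ U L : Set ℂ, IsOpen U ∧ IsPreconnected U ∧ U.Nonempty ∧ K ⊆ U ∧ U ⊆ L ∧ IsCompact L ∧
      L ⊆ Ω := by
  obtain ⟨z₀, hz₀, hjoin⟩ := hc
  have hr : ∀ z ∈ K, ∃ r > 0, closedBall z r ⊆ Ω := fun z hz =>
    nhds_basis_closedBall.mem_iff.1 (hΩ.mem_nhds (hKΩ hz))
  choose! r hr0 hr using hr
  have hp : ∀ z ∈ K, ∃ P : Set ℂ, IsCompact P ∧ IsPreconnected P ∧ z₀ ∈ P ∧ z ∈ P ∧ P ⊆ Ω := by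
    intro z hz
    have γ := hjoin (hKΩ hz)
    refine ⟨range γ.somePath, isCompact_range γ.somePath.continuous,
      isPreconnected_range γ.somePath.continuous, ⟨0, by simp⟩, ⟨1, by simp⟩, ?_⟩
    rintro _ ⟨t, rfl⟩
    exact γ.somePath_mem t
  choose! P hPc hPp hP0 hP1 hPΩ using hp
  obtain ⟨T, hTK, hTcov⟩ := hK.elim_nhds_subcover (fun z => ball z (r z))
    fun z hz => ball_mem_nhds z (hr0 z hz)
  set C : Set ℂ := {z₀} ∪ ⋃ z ∈ T, (P z ∪ closedBall z (r z)) with hC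
  have hCc : IsCompact C := isCompact_singleton.union
    (T.isCompact_biUnion fun z hz => (hPc z (hTK z hz)).union (isCompact_closedBall _ _))
  have hCΩ : C ⊆ Ω := union_subset (singleton_subset_iff.2 hz₀)
    (iUnion₂_subset fun z hz => union_subset (hPΩ z (hTK z hz)) (hr z (hTK z hz)))
  have hCp : IsPreconnected C := by
    refine isPreconnected_of_forall z₀ fun w hw => ?_
    rcases hw with hw | hw
    · exact ⟨{z₀}, subset_union_left, rfl, hw, isPreconnected_singleton⟩
    · obtain ⟨z, hz, hw⟩ := mem_iUnion₂.1 hw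
      exact ⟨P z ∪ closedBall z (r z), (subset_biUnion_of_mem (u := fun z => P z ∪ closedBall z (r z))
        hz).trans subset_union_right, Or.inl (hP0 z (hTK z hz)), hw,
        (hPp z (hTK z hz)).union z (hP1 z (hTK z hz)) (mem_closedBall_self (hr0 z (hTK z hz)).le)
          (convex_closedBall z (r z)).isPreconnected⟩
  have hKC : K ⊆ C := fun w hw => by
    obtain ⟨z, hz, hwz⟩ := mem_iUnion₂.1 (hTcov hw)
    exact Or.inr (mem_iUnion₂.2 ⟨z, hz, Or.inr (ball_subset_closedBall hwz)⟩)
  obtain ⟨δ, hδ, hδΩ⟩ := hCc.exists_cthickening_subset_open hΩ hCΩ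
  have hsub := self_subset_thickening hδ C
  refine ⟨thickening δ C, cthickening δ C, isOpen_thickening, ?_, ⟨z₀, hsub (Or.inl rfl)⟩,
    hKC.trans hsub, thickening_subset_cthickening δ C, hCc.cthickening, hδΩ⟩
  refine isPreconnected_of_forall z₀ fun w hw => ?_
  obtain ⟨z, hz, hwz⟩ := mem_thickening_iff.1 hw
  exact ⟨C ∪ ball z δ, union_subset hsub (ball_subset_thickening hz δ), Or.inl (Or.inl rfl),
    Or.inr hwz, hCp.union z hz (mem_ball_self hδ) (convex_ball z δ).isPreconnected⟩

theorem MeromorphicFunction.meromorphicAt {Ω : Opens ℂ} (g : MeromorphicFunction Ω) (z : Ω) :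
    MeromorphicAt (finitePart g) z := by
  by_cases hz : g z = infty
  · exact (g.pole z hz).1
  · exact (g.analyticAt z hz).meromorphicAt

/-- The poles of a meromorphic function in a compact set are finite in number. -/
theorem MeromorphicFunction.finite_poles {Ω : Opens ℂ} (g : MeromorphicFunction Ω) {H : Set ℂ}
    (hH : IsCompact H) (hHΩ : H ⊆ Ω) : {z ∈ H | ∃ h : z ∈ Ω, g ⟨z, h⟩ = infty}.Finite := by
  by_contra hinf
  obtain ⟨z, hzH, hz⟩ := Set.Infinite.exists_accPt_of_subset_isCompact hinf hH (sep_subset _ _)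
  -- A meromorphic function is analytic on a punctured neighbourhood of the accumulation point,
  -- which leaves no room for poles.
  obtain ⟨w, ⟨-, hwΩ, hw⟩, hwa⟩ := ((accPt_iff_frequently_nhdsNE.1 hz).and_eventually
    (g.meromorphicAt ⟨z, hHΩ hzH⟩).eventually_analyticAt).exists
  exact absurd hwa.meromorphicOrderAt_nonneg (not_le.2 (g.pole ⟨w, hwΩ⟩ hw).2)

/-- A locally univalent function is, near a compact set, a quotient of two holomorphic functions
with nonvanishing Wronskian. -/
theorem LocallyUnivalentFunction.exists_homogeneous {Ω : Opens ℂ} (g : LocallyUnivalentFunction Ω)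
    {H : Set ℂ} (hH : IsCompact H) (hHΩ : H ⊆ Ω) :
    ∃ v₁ v₂ : ℂ → ℂ, AnalyticOnNhd ℂ v₁ H ∧ AnalyticOnNhd ℂ v₂ H ∧
      (∀ z ∈ H, wronskian (v₁ z, deriv v₁ z) (v₂ z, deriv v₂ z) ≠ 0) ∧
      ∀ z : Ω, (z : ℂ) ∈ H → g.1 z = proj (v₁ z, v₂ z) := by
  classical
  set F := finitePart g.1 with hF
  set P := (g.1.finite_poles hH hHΩ).toFinset with hP
  have hPmem : ∀ z : Ω, (z : ℂ) ∈ H → ((z : ℂ) ∈ P ↔ g.1 z = infty) := fun z hz => by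
    simp [hP, hz]
  set v₂ : ℂ → ℂ := fun z => ∏ p ∈ P, (z - p) with hv₂
  have hv₂d : Differentiable ℂ v₂ := by
    simp only [hv₂]; fun_prop
  have hv₂a : AnalyticOnNhd ℂ v₂ H := fun z _ => hv₂d.analyticAt z
  have hv₂0 : ∀ z, v₂ z = 0 ↔ z ∈ P := fun z => by
    simp [hv₂, Finset.prod_eq_zero_iff, sub_eq_zero]
  have hv₂' : ∀ z ∈ P, deriv v₂ z ≠ 0 := fun z hz => by
    have e : v₂ = fun w => (w - z) * ∏ p ∈ P.erase z, (w - p) := by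
      ext w; exact (Finset.mul_prod_erase P (fun p => w - p) hz).symm
    have hd : HasDerivAt v₂ (1 * ∏ p ∈ P.erase z, (z - p)
        + (z - z) * deriv (fun w => ∏ p ∈ P.erase z, (w - p)) z) z := by
      rw [e]
      refine ((hasDerivAt_id z).sub_const z).mul (DifferentiableAt.hasDerivAt ?_)
      fun_prop
    rw [hd.deriv, sub_self, zero_mul, add_zero, one_mul]
    exact Finset.prod_ne_zero_iff.2 fun p hp => sub_ne_zero.2 (Finset.ne_of_mem_erase hp).symm
  set M : ℂ → ℂ := fun z => F z * v₂ z with hM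
  have hMm : MeromorphicOn M H := fun z hz =>
    (g.1.meromorphicAt ⟨z, hHΩ hz⟩).mul (hv₂a z hz).meromorphicAt
  -- The poles being simple, `F v₂` has order `-1 + 1 = 0` at each of them; the normal form fills in
  -- the removable, nonzero values.
  set v₁ := toMeromorphicNFOn M H with hv₁
  have hNF : MeromorphicNFOn v₁ H := meromorphicNFOn_toMeromorphicNFOn M H
  have heq : ∀ z ∈ H, M =ᶠ[𝓝[≠] z] v₁ := fun z hz =>
    (hMm.toMeromorphicNFOn_eq_self_on_nhdsNE hz).symm
  have hord : ∀ z ∈ H, z ∈ P → meromorphicOrderAt v₁ z = 0 := fun z hz hzP => by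
    have hzi := (hPmem ⟨z, hHΩ hz⟩ hz).1 hzP
    have h1 : meromorphicOrderAt F z = -1 := by
      have h2 := (g.1.pole ⟨z, hHΩ hz⟩ hzi).2
      have h3 := g.2.1 ⟨z, hHΩ hz⟩ hzi
      change -1 ≤ meromorphicOrderAt F z at h3
      change meromorphicOrderAt F z < 0 at h2
      obtain ⟨n, hn⟩ := WithTop.ne_top_iff_exists.1 h2.ne_top
      rw [← hn] at h2 h3 ⊢
      have h2' : n < 0 := by exact_mod_cast h2
      have h3' : -1 ≤ n := WithTop.coe_le_coe.1 h3
      have : n = -1 := by omega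
      rw [this]; rfl
    have h2 : meromorphicOrderAt v₂ z = 1 := by
      rw [(hv₂a z hz).meromorphicOrderAt_eq,
        (hv₂a z hz).analyticOrderAt_eq_one_of_zero_deriv_ne_zero ((hv₂0 z).2 hzP) (hv₂' z hzP)]
      rfl
    rw [← meromorphicOrderAt_congr (heq z hz), hM,
      show (fun z => F z * v₂ z) = F * v₂ from rfl,
      meromorphicOrderAt_mul (g.1.meromorphicAt ⟨z, hHΩ hz⟩) (hv₂a z hz).meromorphicAt, h1, h2]
    rfl
  have hFa : ∀ z ∈ H, z ∉ P → AnalyticAt ℂ F z := fun z hz hzP =>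
    g.1.analyticAt ⟨z, hHΩ hz⟩ fun h => hzP ((hPmem ⟨z, hHΩ hz⟩ hz).2 h)
  have hv₁M : ∀ z ∈ H, z ∉ P → v₁ =ᶠ[𝓝 z] M := fun z hz hzP =>
    ((hNF hz).eventuallyEq_nhdsNE_iff_eventuallyEq_nhds
      ((hFa z hz hzP).mul (hv₂a z hz)).meromorphicNFAt).1 (heq z hz).symm
  have hv₁a : AnalyticOnNhd ℂ v₁ H := fun z hz => by
    by_cases hzP : z ∈ P
    · exact (hNF hz).meromorphicOrderAt_nonneg_iff_analyticAt.1 (hord z hz hzP).ge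
    · exact (((hFa z hz hzP).mul (hv₂a z hz)).congr (hv₁M z hz hzP).symm)
  refine ⟨v₁, v₂, hv₁a, hv₂a, fun z hz => ?_, fun z hz => ?_⟩
  · by_cases hzP : z ∈ P
    · have h1 : v₁ z ≠ 0 := (hNF hz).meromorphicOrderAt_eq_zero_iff.1 (hord z hz hzP)
      simp only [wronskian, (hv₂0 z).2 hzP, mul_zero, zero_sub, neg_ne_zero]
      exact mul_ne_zero h1 (hv₂' z hzP)
    · have h1 := (hv₁M z hz hzP).eq_of_nhds
      have h2 : deriv v₁ z = deriv F z * v₂ z + F z * deriv v₂ z := by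
        rw [(hv₁M z hz hzP).deriv_eq]
        exact deriv_fun_mul (hFa z hz hzP).differentiableAt hv₂d.differentiableAt
      have h3 : deriv F z ≠ 0 :=
        g.2.2 ⟨z, hHΩ hz⟩ fun h => hzP ((hPmem ⟨z, hHΩ hz⟩ hz).2 h)
      have h4 : v₂ z ≠ 0 := fun h => hzP ((hv₂0 z).1 h)
      have e : wronskian (v₁ z, deriv v₁ z) (v₂ z, deriv v₂ z) = deriv F z * v₂ z ^ 2 := by
        simp only [wronskian, h1, h2, hM]; ring
      rw [e]
      exact mul_ne_zero h3 (pow_ne_zero 2 h4)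
  · by_cases hzP : (z : ℂ) ∈ P
    · rw [(hPmem z hz).1 hzP]
      exact (proj_eq_infty_iff.2 ((hv₂0 z).2 hzP)).symm
    · have h4 : v₂ z ≠ 0 := fun h => hzP ((hv₂0 z).1 h)
      have h5 : g.1 z ≠ infty := fun h => hzP ((hPmem z hz).2 h)
      have h6 : F z = (g.1 z).toComplex := finitePart_of_mem _ z.2
      rw [(hv₁M z hz hzP).eq_of_nhds, proj, if_neg h4, hM]
      simp only
      rw [mul_div_cancel_right₀ _ h4, h6, ofComplex_toComplex h5]

/-- Two holomorphic functions with nonvanishing Wronskian solve a common linear differential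
equation of the second order. -/
theorem exists_companion_of_wronskian_ne_zero {v₁ v₂ : ℂ → ℂ} {H : Set ℂ}
    (h₁ : AnalyticOnNhd ℂ v₁ H) (h₂ : AnalyticOnNhd ℂ v₂ H)
    (hw : ∀ z ∈ H, wronskian (v₁ z, deriv v₁ z) (v₂ z, deriv v₂ z) ≠ 0) :
    ∃ p q : ℂ → ℂ, AnalyticOnNhd ℂ p H ∧ AnalyticOnNhd ℂ q H ∧
      (∀ z ∈ H, HasDerivAt (fun z => (v₁ z, deriv v₁ z))
        (companion (p z, q z) (v₁ z, deriv v₁ z)) z) ∧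
      ∀ z ∈ H, HasDerivAt (fun z => (v₂ z, deriv v₂ z))
        (companion (p z, q z) (v₂ z, deriv v₂ z)) z := by
  set W : ℂ → ℂ := fun z => wronskian (v₁ z, deriv v₁ z) (v₂ z, deriv v₂ z) with hW
  have hWa : AnalyticOnNhd ℂ W H := fun z hz =>
    ((h₁ z hz).deriv.mul (h₂ z hz)).sub ((h₁ z hz).mul (h₂ z hz).deriv)
  have hd : ∀ v : ℂ → ℂ, AnalyticOnNhd ℂ v H → ∀ z ∈ H,
      HasDerivAt (fun z => (v z, deriv v z)) (deriv v z, deriv (deriv v) z) z := fun v hv z hz =>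
    (hv z hz).differentiableAt.hasDerivAt.prodMk (hv z hz).deriv.differentiableAt.hasDerivAt
  set C : ℂ → ℂ × ℂ := fun z => cramerCoeff (v₁ z, deriv v₁ z) (v₂ z, deriv v₂ z)
    (deriv (deriv v₁) z) (deriv (deriv v₂) z)
  refine ⟨fun z => (C z).1, fun z => (C z).2, fun z hz => ?_, fun z hz => ?_, fun z hz => ?_,
    fun z hz => ?_⟩
  · exact (((h₁ z hz).deriv.deriv.mul (h₂ z hz)).sub
      ((h₁ z hz).mul (h₂ z hz).deriv.deriv)).div (hWa z hz) (hw z hz)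
  · exact (((h₁ z hz).deriv.mul (h₂ z hz).deriv.deriv).sub
      ((h₁ z hz).deriv.deriv.mul (h₂ z hz).deriv)).div (hWa z hz) (hw z hz)
  · exact (hd v₁ h₁ z hz).congr_deriv (companion_cramerCoeff_left (hw z hz) _ _).symm
  · exact (hd v₂ h₂ z hz).congr_deriv (companion_cramerCoeff_right (hw z hz) _ _).symm

/-- Continuous dependence of the solutions on the coefficients and the initial values, on a
connected open set. -/
theorem tendstoLocallyUniformlyOn_of_companion {ι : Type*} {l : Filter ι} {U : Set ℂ} {z₀ : ℂ}
    {x c : ℂ → ℂ × ℂ} {y d : ι → ℂ → ℂ × ℂ} (hU : IsOpen U) (hUp : IsPreconnected U)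
    (hz₀ : z₀ ∈ U) (hx : ∀ z ∈ U, HasDerivAt x (companion (c z) (x z)) z)
    (hy : ∀ i, ∀ z ∈ U, HasDerivAt (y i) (companion (d i z) (y i z)) z)
    (hc : ContinuousOn c U) (hdc : TendstoUniformlyOn d c l U)
    (h0 : Tendsto (fun i => y i z₀) l (𝓝 (x z₀))) :
    TendstoLocallyUniformlyOn y x l U := by
  -- Convergence at any one point of a small disc spreads to the whole disc. So the set of good
  -- points is open and relatively closed in `U`.
  have key : ∀ z ∈ U, ∃ r > 0, closedBall z r ⊆ U ∧ ∀ w ∈ ball z r,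
      Tendsto (fun i => y i w) l (𝓝 (x w)) →
        TendstoUniformlyOn y x l (ball z r) := by
    intro z hz
    obtain ⟨r, hr0, hr⟩ := nhds_basis_closedBall.mem_iff.1 (hU.mem_nhds hz)
    refine ⟨r / 4, by positivity, (closedBall_subset_closedBall (by linarith)).trans hr,
      fun w hw hlim => ?_⟩
    have hsub : closedBall w (r / 2) ⊆ U := (closedBall_subset_closedBall' (by
      rw [mem_ball] at hw; linarith)).trans hr
    refine (tendstoUniformlyOn_closedBall_of_companion (by positivity)
      (fun z hz => hx z (hsub hz)) (fun i z hz => hy i z (hsub hz)) (hc.mono hsub)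
      (hdc.mono hsub) hlim).mono (ball_subset_closedBall.trans (closedBall_subset_closedBall' ?_))
    rw [mem_ball'] at hw; linarith
  have hall : ∀ z ∈ U, Tendsto (fun i => y i z) l (𝓝 (x z)) := by
    have := hUp.subset_of_closure_inter_subset
      (u := {z | ∃ r > 0, ball z r ⊆ U ∧ TendstoUniformlyOn y x l (ball z r)}) ?_ ?_ ?_
    · intro z hz
      obtain ⟨r, hr, -, h⟩ := this hz
      exact h.tendsto_at (mem_ball_self hr)
    · rw [Metric.isOpen_iff]
      rintro z ⟨r, hr, hrU, h⟩
      refine ⟨r / 2, by positivity, fun w hw => ⟨r / 2, by positivity, ?_, ?_⟩⟩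
      · exact (ball_subset_ball' (by rw [mem_ball] at hw; linarith)).trans hrU
      · exact h.mono (ball_subset_ball' (by rw [mem_ball] at hw; linarith))
    · obtain ⟨r, hr, hrU, h⟩ := key z₀ hz₀
      exact ⟨z₀, hz₀, r, hr, ball_subset_closedBall.trans hrU, h z₀ (mem_ball_self hr) h0⟩
    · rintro z ⟨hz, hzU⟩
      obtain ⟨r, hr, hrU, h⟩ := key z hzU
      obtain ⟨w, ⟨s, hs, -, hw⟩, hwz⟩ := Metric.mem_closure_iff.1 hz r hr
      exact ⟨r, hr, ball_subset_closedBall.trans hrU,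
        h w (by rwa [mem_ball']) (hw.tendsto_at (mem_ball_self hs))⟩
  intro V hV z hz
  obtain ⟨r, hr, -, h⟩ := key z hz
  exact ⟨ball z r, mem_nhdsWithin_of_mem_nhds (ball_mem_nhds z hr),
    h z (mem_ball_self hr) (hall z hz) V hV⟩

/-- Two holomorphic functions without common zeros on a compact set are bounded away from `0`. -/
theorem exists_pos_forall_le_norm {u : ℂ → ℂ × ℂ} {K : Set ℂ} (hK : IsCompact K)
    (hu : ContinuousOn u K) (h0 : ∀ z ∈ K, u z ≠ 0) : ∃ m > 0, ∀ z ∈ K, m ≤ ‖u z‖ := by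
  rcases K.eq_empty_or_nonempty with rfl | hne
  · exact ⟨1, one_pos, by simp⟩
  · obtain ⟨z, hz, hmin⟩ := hK.exists_isMinOn hne hu.norm
    exact ⟨‖u z‖, norm_pos_iff.2 (h0 z hz), fun w hw => hmin hw⟩

/-- A locally univalent function on a simply connected domain is a limit of quotients of entire
solutions of linear differential equations. -/
theorem LocallyUnivalentFunction.exists_entire_approx {Ω : Opens ℂ}
    (hΩ : IsSimplyConnected (Ω : Set ℂ)) (g : LocallyUnivalentFunction Ω) {K : Set ℂ}
    (hK : IsCompact K) (hKΩ : K ⊆ Ω) {ε : ℝ} (hε : 0 < ε) :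
    ∃ c x y : ℂ → ℂ × ℂ, Differentiable ℂ c ∧
      (∀ z, HasDerivAt x (companion (c z) (x z)) z) ∧
      (∀ z, HasDerivAt y (companion (c z) (y z)) z) ∧ (∀ z, wronskian (x z) (y z) ≠ 0) ∧
      ∀ z : Ω, (z : ℂ) ∈ K → dist (proj ((x z).1, (y z).1)) (g.1 z) < ε := by
  obtain ⟨U, L, hU, hUp, ⟨z₀, hz₀⟩, hKU, hUL, hL, hLΩ⟩ :=
    exists_isPreconnected_between Ω.isOpen hΩ.isPathConnected hK hKΩ
  have : CompactSpace L := isCompact_iff_compactSpace.1 hL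
  have hULH := hUL.trans (subset_polynomialHull L)
  obtain ⟨v₁, v₂, ha₁, ha₂, hw, hg⟩ := g.exists_homogeneous (isCompact_polynomialHull L)
    (polynomialHull_subset Ω.isOpen hΩ hLΩ)
  obtain ⟨p, q, hp, hq, hX, hY⟩ := exists_companion_of_wronskian_ne_zero ha₁ ha₂ hw
  set X : ℂ → ℂ × ℂ := fun z => (v₁ z, deriv v₁ z)
  set Y : ℂ → ℂ × ℂ := fun z => (v₂ z, deriv v₂ z)
  have hpos : ∀ n : ℕ, (0 : ℝ) < 1 / (n + 1) := fun n => Nat.one_div_pos_of_nat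
  -- Runge is applied to the coefficients, not to `g`: any approximation of them still yields
  -- locally univalent quotients.
  choose P hP using fun n : ℕ => exists_polynomial_approx hp (hpos n)
  choose Q hQ using fun n : ℕ => exists_polynomial_approx hq (hpos n)
  have hdiff : ∀ n, Differentiable ℂ fun z => ((P n).eval z, (Q n).eval z) := fun n =>
    (P n).differentiable.prodMk (Q n).differentiable
  choose x hx0 hx using fun n => exists_entire_solution (hdiff n) z₀ (X z₀)
  choose y hy0 hy using fun n => exists_entire_solution (hdiff n) z₀ (Y z₀)
  have hconv : TendstoUniformlyOn (fun n z => ((P n).eval z, (Q n).eval z))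
      (fun z => (p z, q z)) atTop U := by
    rw [Metric.tendstoUniformlyOn_iff]
    intro δ hδ
    filter_upwards [(tendsto_order.1 tendsto_one_div_add_atTop_nhds_zero_nat).2 δ hδ] with n hn z hz
    rw [dist_comm, dist_eq_norm]
    exact max_lt ((hP n z (hUL hz)).trans hn) ((hQ n z (hUL hz)).trans hn)
  have hcont : ContinuousOn (fun z => (p z, q z)) U :=
    (hp.continuousOn.prodMk hq.continuousOn).mono hULH
  have hKc : ∀ {x' : ℕ → ℂ → ℂ × ℂ} {X' : ℂ → ℂ × ℂ}, TendstoLocallyUniformlyOn x' X' atTop U →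
      TendstoUniformlyOn x' X' atTop K := fun h =>
    (tendstoLocallyUniformlyOn_iff_forall_isCompact hU).1 h K hKU hK
  have hxc := hKc (tendstoLocallyUniformlyOn_of_companion hU hUp hz₀
    (fun z hz => hX z (hULH hz)) (fun n z _ => hx n z) hcont hconv (by simp [hx0]))
  have hyc := hKc (tendstoLocallyUniformlyOn_of_companion hU hUp hz₀
    (fun z hz => hY z (hULH hz)) (fun n z _ => hy n z) hcont hconv (by simp [hy0]))
  have hv0 : ∀ z ∈ K, (v₁ z, v₂ z) ≠ 0 := fun z hz =>
    fst_ne_zero_of_wronskian (hw z (hULH (hKU hz)))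
  obtain ⟨m, hm, hmle⟩ := exists_pos_forall_le_norm hK
    ((ha₁.continuousOn.prodMk ha₂.continuousOn).mono (hKU.trans hULH)) hv0
  rw [Metric.tendstoUniformlyOn_iff] at hxc hyc
  have hδ : 0 < m * ε / 2 := by positivity
  obtain ⟨n, hnx, hny⟩ := ((hxc _ hδ).and (hyc _ hδ)).exists
  have hwn : ∀ z, wronskian (x n z) (y n z) ≠ 0 := wronskian_ne_zero (hdiff n) (hx n) (hy n)
    (z₀ := z₀) (by rw [hx0, hy0]; exact hw z₀ (hULH hz₀))
  refine ⟨_, x n, y n, hdiff n, hx n, hy n, hwn, fun z hz => ?_⟩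
  rw [hg z (hULH (hKU hz)), dist_comm]
  refine (dist_proj_le (hv0 z hz) (fst_ne_zero_of_wronskian (hwn z))).trans_lt ?_
  have h1 : ‖(v₁ z, v₂ z) - ((x n z).1, (y n z).1)‖ < m * ε / 2 := by
    have h2 := hnx z hz
    have h3 := hny z hz
    rw [dist_eq_norm] at h2 h3
    exact max_lt ((norm_fst_le (X z - x n z)).trans_lt h2) ((norm_fst_le (Y z - y n z)).trans_lt h3)
  have h4 := hmle z hz
  rw [div_lt_iff₀ (hm.trans_le h4)]
  nlinarith

/-! ### Gaussian approximation -/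

/-- The Gaussian kernel, normalized to have integral `1` along horizontal lines. -/
noncomputable def gaussKernel (b : ℝ) (z : ℂ) : ℂ := (√(b / Real.pi) : ℝ) * Complex.exp (-b * z ^ 2)

/-- Completing the square with a complex linear term. That `z` need not be real is what makes the
convolution useful on discs. -/
theorem integral_gaussKernel {b : ℝ} (hb : 0 < b) (z : ℂ) : ∫ t : ℝ, gaussKernel b (z - t) = 1 := by
  have h := integral_cexp_quadratic (b := (-b : ℂ)) (by simpa using hb) (2 * b * z) (-b * z ^ 2)
  have e : ∀ t : ℝ, Complex.exp (-b * t ^ 2 + 2 * b * z * t + -b * z ^ 2)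
      = Complex.exp (-b * (z - t) ^ 2) := fun t => by congr 1; ring
  simp only [e] at h
  have hb' : (b : ℂ) ≠ 0 := by exact_mod_cast hb.ne'
  have h0 : (-b * z ^ 2 - (2 * b * z) ^ 2 / (4 * -b) : ℂ) = 0 := by field_simp; ring
  have h1 : ((Real.pi : ℂ) / - -b) ^ (1 / 2 : ℂ) = (√(Real.pi / b) : ℝ) := by
    rw [neg_neg, Real.sqrt_eq_rpow, Complex.ofReal_cpow (by positivity)]
    push_cast
    rfl
  simp only [gaussKernel]
  rw [integral_const_mul, h, h0, h1, Complex.exp_zero, mul_one, ← Complex.ofReal_mul,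
    ← Real.sqrt_mul (by positivity)]
  have : b / Real.pi * (Real.pi / b) = 1 := by field_simp
  rw [this]
  simp

theorem norm_gaussKernel_sub (b : ℝ) (z : ℂ) (t : ℝ) : ‖gaussKernel b (z - t)‖ =
    √(b / Real.pi) * Real.exp (-b * ((t - z.re) ^ 2 - z.im ^ 2)) := by
  rw [gaussKernel, norm_mul, Complex.norm_real, Real.norm_of_nonneg (Real.sqrt_nonneg _),
    Complex.norm_exp]
  congr 2
  rw [← Complex.ofReal_neg, Complex.re_ofReal_mul]
  simp [pow_two]
  ring_nf
  simp

theorem integrable_gaussKernel {b : ℝ} (hb : 0 < b) (z : ℂ) :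
    Integrable fun t : ℝ => gaussKernel b (z - t) := by
  -- The integral of a nonintegrable function is `0` by convention, whereas this one is `1`.
  by_contra h
  have := integral_gaussKernel hb z
  rw [integral_undef h] at this
  exact zero_ne_one this

theorem differentiable_gaussKernel (b : ℝ) : Differentiable ℂ (gaussKernel b) := by
  unfold gaussKernel; fun_prop

section GaussConv

variable {E : Type*} [NormedAddCommGroup E] [NormedSpace ℂ E]

/-- The convolution of `ψ` with the Gaussian kernel, extended to the complex plane. -/
noncomputable def gaussConv (ψ : ℝ → E) (b : ℝ) (z : ℂ) : E := ∫ t : ℝ, gaussKernel b (z - t) • ψ t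

theorem differentiable_gaussConv {ψ : ℝ → E} (hψ : Continuous ψ) (hc : HasCompactSupport ψ) (b : ℝ) :
    Differentiable ℂ (gaussConv ψ b) := by
  intro z₀
  have hK := differentiable_gaussKernel b
  have hK' : Continuous (deriv (gaussKernel b)) := (hK.contDiff (n := 1)).continuous_deriv le_rfl
  have hcont : Continuous fun p : ℂ × ℝ => deriv (gaussKernel b) (p.1 - p.2) • ψ p.2 := by fun_prop
  obtain ⟨C, hC⟩ := ((isCompact_closedBall z₀ 1).prod
    (show IsCompact (tsupport ψ) from hc)).exists_bound_of_continuousOn hcont.continuousOn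
  refine (hasDerivAt_integral_of_dominated_loc_of_deriv_le (𝕜 := ℂ)
    (F := fun z t => gaussKernel b (z - t) • ψ t)
    (F' := fun z t => deriv (gaussKernel b) (z - t) • ψ t)
    (bound := (tsupport ψ).indicator fun _ => C) (closedBall_mem_nhds z₀ one_pos) ?_ ?_ ?_ ?_ ?_
    ?_).2.differentiableAt
  · have := hK.continuous
    exact Eventually.of_forall fun z => Continuous.aestronglyMeasurable (by fun_prop)
  · have := hK.continuous
    exact Continuous.integrable_of_hasCompactSupport (by fun_prop) hc.smul_left
  · exact Continuous.aestronglyMeasurable (by fun_prop)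
  · refine Eventually.of_forall fun t z hz => ?_
    by_cases ht : t ∈ tsupport ψ
    · rw [indicator_of_mem ht]
      exact hC (z, t) ⟨hz, ht⟩
    · rw [indicator_of_notMem ht, image_eq_zero_of_notMem_tsupport ht, smul_zero, norm_zero]
  · exact (integrable_indicator_iff (isClosed_tsupport ψ).measurableSet).2
      (integrableOn_const hc.measure_lt_top.ne)
  · refine Eventually.of_forall fun t z _ => ?_
    exact ((hK (z - t)).hasDerivAt.comp_sub_const z t).smul_const (ψ t)

/-- Off the real line the kernel is large for `|t - z.re| < |z.im|`, so `ψ = c` is required wherever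
`|t - z.re| < 2 |z.im|`. Elsewhere the kernel decays like a real Gaussian, and the integral is split
at distance `δ`. -/
theorem norm_gaussConv_sub_le [CompleteSpace E] {ψ : ℝ → E} {b τ M δ : ℝ} {z : ℂ} {c : E}
    (hb : 0 < b) (hψ : Continuous ψ) (hc : HasCompactSupport ψ) (hδ : 0 < δ) (hτ : 0 ≤ τ)
    (hM : ∀ t, ‖ψ t - c‖ ≤ M) (hnear : ∀ t, |t - z.re| < δ → ‖ψ t - c‖ ≤ τ)
    (hfar : ∀ t, ψ t ≠ c → 2 * |z.im| ≤ |t - z.re|) :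
    ‖gaussConv ψ b z - c‖ ≤ 2 * (τ + M * Real.exp (-b * δ ^ 2 / 4)) := by
  have hM0 : 0 ≤ M := (norm_nonneg _).trans (hM 0)
  have hi1 : Integrable fun t : ℝ => gaussKernel b (z - t) • ψ t := by
    have := (differentiable_gaussKernel b).continuous
    exact Continuous.integrable_of_hasCompactSupport (by fun_prop) hc.smul_left
  have hi2 := (integrable_gaussKernel hb z).smul_const c
  have e : gaussConv ψ b z - c = ∫ t : ℝ, gaussKernel b (z - t) • (ψ t - c) := by
    have : c = ∫ t : ℝ, gaussKernel b (z - t) • c := by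
      rw [integral_smul_const, integral_gaussKernel hb, one_smul]
    simp only [smul_sub]
    rw [integral_sub hi1 hi2, ← this]
    rfl
  set A := τ + M * Real.exp (-b * δ ^ 2 / 4) with hA
  have hA0 : 0 ≤ A := by positivity
  have hbound : ∀ t : ℝ, ‖gaussKernel b (z - t) • (ψ t - c)‖ ≤
      √(b / Real.pi) * A * Real.exp (-(b / 2) * (t - z.re) ^ 2) := fun t => by
    rw [norm_smul, norm_gaussKernel_sub]
    by_cases ht : ψ t = c
    · rw [ht, sub_self, norm_zero, mul_zero]; positivity
    have hy : 4 * z.im ^ 2 ≤ (t - z.re) ^ 2 := by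
      have := hfar t ht
      rw [← sq_abs z.im, ← sq_abs (t - z.re)]
      nlinarith [abs_nonneg z.im]
    -- At least three quarters of the exponent survive: one half is kept for integrability, one
    -- quarter for smallness beyond `δ`.
    have h1 : Real.exp (-b * ((t - z.re) ^ 2 - z.im ^ 2)) ≤
        Real.exp (-(b / 2) * (t - z.re) ^ 2) * Real.exp (-b * (t - z.re) ^ 2 / 4) := by
      rw [← Real.exp_add]
      gcongr
      nlinarith
    have h2 : Real.exp (-b * (t - z.re) ^ 2 / 4) * ‖ψ t - c‖ ≤ A := by
      by_cases hd : |t - z.re| < δ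
      · have : Real.exp (-b * (t - z.re) ^ 2 / 4) ≤ 1 := by
          rw [Real.exp_le_one_iff]
          have := mul_nonneg hb.le (sq_nonneg (t - z.re))
          linarith
        have h3 := hnear t hd
        have h4 := Real.exp_pos (-b * δ ^ 2 / 4)
        nlinarith [norm_nonneg (ψ t - c), mul_nonneg hM0 h4.le]
      · rw [not_lt] at hd
        have h3 : δ ^ 2 ≤ (t - z.re) ^ 2 := by
          rw [← sq_abs (t - z.re)]
          gcongr
        have : Real.exp (-b * (t - z.re) ^ 2 / 4) ≤ Real.exp (-b * δ ^ 2 / 4) := by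
          rw [Real.exp_le_exp]
          nlinarith
        calc _ ≤ Real.exp (-b * δ ^ 2 / 4) * M := by
              gcongr; exact hM t
          _ ≤ A := by rw [hA]; linarith
    calc _ ≤ √(b / Real.pi) * (Real.exp (-(b / 2) * (t - z.re) ^ 2) *
          Real.exp (-b * (t - z.re) ^ 2 / 4)) * ‖ψ t - c‖ := by gcongr
      _ = √(b / Real.pi) * Real.exp (-(b / 2) * (t - z.re) ^ 2) *
          (Real.exp (-b * (t - z.re) ^ 2 / 4) * ‖ψ t - c‖) := by ring
      _ ≤ √(b / Real.pi) * Real.exp (-(b / 2) * (t - z.re) ^ 2) * A := by gcongr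
      _ = _ := by ring
  have hg : Integrable fun t : ℝ => √(b / Real.pi) * A * Real.exp (-(b / 2) * (t - z.re) ^ 2) :=
    ((integrable_exp_neg_mul_sq (by positivity : 0 < b / 2)).comp_sub_right z.re).const_mul _
  rw [e]
  refine (norm_integral_le_of_norm_le hg (Eventually.of_forall hbound)).trans ?_
  rw [integral_const_mul, integral_sub_right_eq_self (fun t => Real.exp (-(b / 2) * t ^ 2)),
    integral_gaussian]
  have h2 : √(b / Real.pi) * √(Real.pi / (b / 2)) ≤ 2 := by
    rw [← Real.sqrt_mul (by positivity)]
    have : b / Real.pi * (Real.pi / (b / 2)) = 2 := by field_simp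
    rw [this, Real.sqrt_le_left (by norm_num)]
    norm_num
  calc _ = √(b / Real.pi) * √(Real.pi / (b / 2)) * A := by ring
    _ ≤ 2 * A := by gcongr

theorem tendsto_exp_neg_mul_sq {δ : ℝ} (hδ : 0 < δ) :
    Tendsto (fun b : ℝ => Real.exp (-b * δ ^ 2 / 4)) atTop (𝓝 0) := by
  refine Real.tendsto_exp_atBot.comp ?_
  have : (fun b : ℝ => -b * δ ^ 2 / 4) = fun b => b * (-(δ ^ 2 / 4)) := by ext; ring
  rw [this]
  exact tendsto_id.atTop_mul_const_of_neg (by simp; positivity)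

/-- Gaussian convolutions converge uniformly on the real line. -/
theorem tendstoUniformly_gaussConv [CompleteSpace E] {ψ : ℝ → E} (hψ : Continuous ψ)
    (hc : HasCompactSupport ψ) :
    TendstoUniformly (fun b (x : ℝ) => gaussConv ψ b x) ψ atTop := by
  obtain ⟨M, hM⟩ := hψ.bounded_above_of_compact_support hc
  have hM0 : 0 ≤ M := (norm_nonneg _).trans (hM 0)
  rw [Metric.tendstoUniformly_iff]
  intro ε hε
  obtain ⟨δ, hδ, huc⟩ := Metric.uniformContinuous_iff.1
    (hc.uniformContinuous_of_continuous hψ) (ε / 4) (by positivity)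
  have hlim := (tendsto_exp_neg_mul_sq hδ).const_mul (2 * M)
  rw [mul_zero] at hlim
  filter_upwards [eventually_gt_atTop 0, (tendsto_order.1 hlim).2 (ε / 4) (by positivity)]
    with b hb hbε x
  rw [dist_comm, dist_eq_norm]
  refine (norm_gaussConv_sub_le hb hψ hc hδ (by positivity : 0 ≤ ε / 4)
    (fun t => (norm_sub_le _ _).trans (add_le_add (hM t) (hM x)))
    (fun t ht => ?_) (fun t _ => by simp)).trans_lt (by linarith)
  rw [← dist_eq_norm]
  exact (huc (by simpa [Real.dist_eq] using ht)).le

/-- Gaussian convolutions converge uniformly on sets of points in whose vicinity `ψ` is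
constant. -/
theorem tendstoUniformlyOn_gaussConv_const [CompleteSpace E] {ψ : ℝ → E} (hψ : Continuous ψ)
    (hc : HasCompactSupport ψ) {S : Set ℂ} {c : E} {δ : ℝ} (hδ : 0 < δ)
    (hS : ∀ z ∈ S, ∀ t, ψ t ≠ c → δ ≤ |t - z.re| ∧ 2 * |z.im| ≤ |t - z.re|) :
    TendstoUniformlyOn (gaussConv ψ) (fun _ => c) atTop S := by
  obtain ⟨M, hM⟩ := hψ.bounded_above_of_compact_support hc
  have hM0 : 0 ≤ M := (norm_nonneg _).trans (hM 0)
  rw [Metric.tendstoUniformlyOn_iff]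
  intro ε hε
  have hlim := (tendsto_exp_neg_mul_sq hδ).const_mul (2 * (M + ‖c‖))
  rw [mul_zero] at hlim
  filter_upwards [eventually_gt_atTop 0, (tendsto_order.1 hlim).2 ε hε] with b hb hbε z hz
  rw [dist_comm, dist_eq_norm]
  refine (norm_gaussConv_sub_le hb hψ hc hδ le_rfl
    (fun t => (norm_sub_le _ _).trans (add_le_add_left (hM t) ‖c‖))
    (fun t ht => ?_) (fun t ht => (hS z hz t ht).2)).trans_lt (by linarith)
  by_contra h
  have : ψ t ≠ c := fun h' => h (by simp [h'])
  exact absurd (hS z hz t this).1 (not_le.2 ht)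

theorem TendstoUniformlyOn.smul_bounded {ι α : Type*} {l : Filter ι} {S : Set α} {f : ι → α → ℂ}
    {g : α → ℂ} {u : α → E} {M : ℝ} (h : TendstoUniformlyOn f g l S) (hu : ∀ x ∈ S, ‖u x‖ ≤ M) :
    TendstoUniformlyOn (fun i x => f i x • u x) (fun x => g x • u x) l S := by
  rw [Metric.tendstoUniformlyOn_iff] at h ⊢
  intro ε hε
  filter_upwards [h (ε / (|M| + 1)) (by positivity)] with i hi x hx
  have h1 := hi x hx
  have h2 := (hu x hx).trans (le_abs_self M)
  rw [dist_eq_norm] at h1 ⊢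
  rw [← sub_smul, norm_smul]
  calc _ ≤ ‖g x - f i x‖ * (|M| + 1) := by gcongr; linarith
    _ < ε / (|M| + 1) * (|M| + 1) := by gcongr
    _ = ε := by field_simp

end GaussConv

/-! ### Connecting two equations along a real segment -/

namespace Polynomial

/-- The state and the second derivative of a polynomial at a point. -/
noncomputable def jet (P : Polynomial ℂ) (z : ℂ) : (ℂ × ℂ) × ℂ :=
  ((P.eval z, P.derivative.eval z), P.derivative.derivative.eval z)

/-- Two-point Hermite interpolation. -/
theorem exists_jet_eq {a b : ℂ} (hab : a ≠ b) (p q : (ℂ × ℂ) × ℂ) :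
    ∃ P : Polynomial ℂ, P.jet a = p ∧ P.jet b = q := by
  have hcop : IsCoprime ((X - C a) ^ 3) ((X - C b) ^ 3) :=
    (isCoprime_X_sub_C_of_isUnit_sub (sub_ne_zero.2 hab).isUnit).pow
  obtain ⟨u, v, huv⟩ := hcop
  let T : ((ℂ × ℂ) × ℂ) → ℂ → Polynomial ℂ := fun p a =>
    C p.1.1 + C p.1.2 * (X - C a) + C (p.2 / 2) * (X - C a) ^ 2
  have hT : ∀ p a, (T p a).jet a = p := fun p a => by
    ext <;> simp [T, jet, derivative_pow]
  have hadd : ∀ (P W : Polynomial ℂ) (a : ℂ), (P + W * (X - C a) ^ 3).jet a = P.jet a :=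
    fun P W a => by ext <;> simp [jet, derivative_pow]
  -- The Chinese remainder theorem modulo the two cubes, applied to the Taylor polynomials `T p a`
  -- and `T q b`.
  refine ⟨T p a + (T q b - T p a) * u * (X - C a) ^ 3, ?_, ?_⟩
  · rw [hadd, hT]
  · have : T p a + (T q b - T p a) * u * (X - C a) ^ 3 =
        T q b + (T p a - T q b) * v * (X - C b) ^ 3 := by
      linear_combination (T q b - T p a) * huv
    rw [this, hadd, hT]

theorem jet_comp (P Q : Polynomial ℂ) (z : ℂ) : (P.comp Q).jet z =
    ((P.eval (Q.eval z), Q.derivative.eval z * P.derivative.eval (Q.eval z)),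
      Q.derivative.derivative.eval z * P.derivative.eval (Q.eval z) +
      Q.derivative.eval z ^ 2 * P.derivative.derivative.eval (Q.eval z)) := by
  ext <;> simp [jet, derivative_comp]
  ring

/-- Two-point Hermite interpolation by a pair of polynomials with nonvanishing Wronskian. -/
theorem exists_jet_eq_of_wronskian_ne_zero {a b : ℝ} (hab : a < b) {pa qa pb qb : (ℂ × ℂ) × ℂ}
    (ha : _root_.wronskian pa.1 qa.1 ≠ 0) (hb : _root_.wronskian pb.1 qb.1 ≠ 0) :
    ∃ P Q : Polynomial ℂ, P.jet a = pa ∧ Q.jet a = qa ∧ P.jet b = pb ∧ Q.jet b = qb ∧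
      ∀ t ∈ Icc a b, _root_.wronskian (P.jet t).1 (Q.jet t).1 ≠ 0 := by
  have hab' : (a : ℂ) ≠ b := by exact_mod_cast hab.ne
  obtain ⟨A, hAa, hAb⟩ := exists_jet_eq hab' pa pb
  obtain ⟨B, hBa, hBb⟩ := exists_jet_eq hab' qa qb
  let W : Polynomial ℂ := derivative A * B - A * derivative B
  have hW : ∀ z, _root_.wronskian (A.jet z).1 (B.jet z).1 = W.eval z := fun z => by
    simp [_root_.wronskian, jet, W]
  have hW0 : W ≠ 0 := fun h => by
    rw [← hAa, ← hBa, hW, h] at ha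
    simp at ha
  -- Each of the finitely many zeros of `W` lies on the open arc of `Γ` for at most one real `μ`;
  -- those values are avoided.
  obtain ⟨μ, hμ⟩ := Finset.exists_notMem
    (W.roots.toFinset.image fun ζ => ζ.im / ((ζ.re - a) ^ 3 * (b - ζ.re) ^ 3))
  -- The cubes make `Γ` agree with the identity to second order at both ends, so composing with `Γ`
  -- preserves the jets there. On the segment `Γ'` has real part `1`.
  let Γ : Polynomial ℂ := X + C (μ * Complex.I) * ((X - C (a : ℂ)) ^ 3 * (C (b : ℂ) - X) ^ 3)
  have hΓa : Γ.jet a = ((↑a, 1), 0) := by ext <;> simp [Γ, jet, derivative_pow]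
  have hΓb : Γ.jet b = ((↑b, 1), 0) := by ext <;> simp [Γ, jet, derivative_pow]
  have hcomp : ∀ (P : Polynomial ℂ) (z : ℂ), Γ.jet z = ((z, 1), 0) → (P.comp Γ).jet z = P.jet z :=
    fun P z h => by
      simp only [jet, Prod.mk.injEq] at h
      rw [jet_comp, h.1.1, h.1.2, h.2]
      simp [jet]
  refine ⟨A.comp Γ, B.comp Γ, (hcomp _ _ hΓa).trans hAa, (hcomp _ _ hΓa).trans hBa,
    (hcomp _ _ hΓb).trans hAb, (hcomp _ _ hΓb).trans hBb, fun t ht => ?_⟩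
  rcases eq_or_lt_of_le ht.1 with rfl | hat
  · rwa [hcomp _ _ hΓa, hcomp _ _ hΓa, hAa, hBa]
  rcases eq_or_lt_of_le ht.2 with rfl | htb
  · rwa [hcomp _ _ hΓb, hcomp _ _ hΓb, hAb, hBb]
  have e : _root_.wronskian ((A.comp Γ).jet t).1 ((B.comp Γ).jet t).1 =
      Γ.derivative.eval ↑t * W.eval (Γ.eval ↑t) := by
    rw [jet_comp, jet_comp]
    simp [_root_.wronskian, W]
    ring
  rw [e]
  refine mul_ne_zero (fun h => ?_) (fun h => hμ ?_)
  · have h1 : Γ.derivative.eval (t : ℂ) = 1 + ((μ * (3 * (t - a) ^ 2 * (b - t) ^ 3 -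
        (t - a) ^ 3 * (3 * (b - t) ^ 2)) : ℝ) : ℂ) * Complex.I := by
      simp [Γ, derivative_pow]
      ring
    rw [h1] at h
    have := congrArg Complex.re h
    rw [Complex.add_re, Complex.re_ofReal_mul] at this
    simp at this
  · have h1 : Γ.eval (t : ℂ) = t + ((μ * ((t - a) ^ 3 * (b - t) ^ 3) : ℝ) : ℂ) * Complex.I := by
      simp [Γ]
      ring
    rw [Finset.mem_image]
    refine ⟨Γ.eval ↑t, by simpa [hW0] using h, ?_⟩
    have hre : (Γ.eval (t : ℂ)).re = t := by
      rw [h1, Complex.add_re, Complex.re_ofReal_mul]; simp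
    have him : (Γ.eval (t : ℂ)).im = μ * ((t - a) ^ 3 * (b - t) ^ 3) := by
      rw [h1, Complex.add_im, Complex.im_ofReal_mul]; simp
    rw [hre, him]
    have : (t - a) ^ 3 * (b - t) ^ 3 ≠ 0 :=
      mul_ne_zero (pow_ne_zero _ (sub_pos.2 hat).ne') (pow_ne_zero _ (sub_pos.2 htb).ne')
    field_simp

theorem hasDerivAt_jet_fst (P : Polynomial ℂ) (t : ℝ) :
    HasDerivAt (fun t : ℝ => (P.jet t).1) ((P.jet t).1.2, (P.jet t).2) t :=
  (P.hasDerivAt (t : ℂ)).comp_ofReal.prodMk (P.derivative.hasDerivAt (t : ℂ)).comp_ofReal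

end Polynomial

theorem continuousOn_cramerCoeff {X : Type*} [TopologicalSpace X] {s : Set X}
    {x y : X → ℂ × ℂ} {a b : X → ℂ}
    (hx : ContinuousOn x s) (hy : ContinuousOn y s) (ha : ContinuousOn a s) (hb : ContinuousOn b s)
    (hw : ∀ t ∈ s, wronskian (x t) (y t) ≠ 0) :
    ContinuousOn (fun t => cramerCoeff (x t) (y t) (a t) (b t)) s := by
  have : ContinuousOn (fun t => wronskian (x t) (y t)) s := by unfold wronskian; fun_prop
  unfold cramerCoeff
  exact ContinuousOn.prodMk (ContinuousOn.div (by fun_prop) this hw)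
    (ContinuousOn.div (by fun_prop) this hw)

/-- Any two linearly independent pairs of states are joined by the solutions of an equation whose
coefficients have prescribed boundary values. -/
theorem exists_connecting_coefficient {a b : ℝ} (hab : a < b) {xa ya xb yb : ℂ × ℂ}
    (ha : wronskian xa ya ≠ 0) (hb : wronskian xb yb ≠ 0) (ca cb : ℂ × ℂ) :
    ∃ c x y : ℝ → ℂ × ℂ, ContinuousOn c (Icc a b) ∧ c a = ca ∧ c b = cb ∧
      (x a = xa ∧ y a = ya ∧ x b = xb ∧ y b = yb) ∧
      (∀ t ∈ Icc a b, HasDerivAt x (companion (c t) (x t)) t) ∧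
      ∀ t ∈ Icc a b, HasDerivAt y (companion (c t) (y t)) t := by
  -- The second derivatives at the ends are those demanded by `ca` and `cb`, so Cramer's rule
  -- returns these values.
  obtain ⟨P, Q, hPa, hQa, hPb, hQb, hw⟩ := Polynomial.exists_jet_eq_of_wronskian_ne_zero hab
    (pa := (xa, (companion ca xa).2)) (qa := (ya, (companion ca ya).2))
    (pb := (xb, (companion cb xb).2)) (qb := (yb, (companion cb yb).2)) ha hb
  have hcont : ∀ P : Polynomial ℂ, Continuous fun t : ℝ => P.jet t := fun P => by
    unfold Polynomial.jet; fun_prop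
  refine ⟨fun t => cramerCoeff (P.jet t).1 (Q.jet t).1 (P.jet t).2 (Q.jet t).2,
    fun t => (P.jet t).1, fun t => (Q.jet t).1,
    continuousOn_cramerCoeff (hcont P).fst.continuousOn (hcont Q).fst.continuousOn
      (hcont P).snd.continuousOn (hcont Q).snd.continuousOn hw, ?_, ?_, ⟨?_, ?_, ?_, ?_⟩,
    fun t ht => ?_, fun t ht => ?_⟩
  · simp only [hPa, hQa, cramerCoeff_companion ha]
  · simp only [hPb, hQb, cramerCoeff_companion hb]
  · simp only [hPa]
  · simp only [hQa]
  · simp only [hPb]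
  · simp only [hQb]
  · rw [companion_cramerCoeff_left (hw t ht)]
    exact P.hasDerivAt_jet_fst t
  · rw [companion_cramerCoeff_right (hw t ht)]
    exact Q.hasDerivAt_jet_fst t

/-! ### Fusion of two equations -/

/-- A continuous function on the line that coincides with given functions on three consecutive
intervals. -/
theorem exists_continuous_glue {E : Type*} [NormedAddCommGroup E] {p q : ℝ} (hpq : p ≤ q)
    {f g h : ℝ → E} (hf : Continuous f) (hg : ContinuousOn g (Icc p q)) (hh : Continuous h)
    (hp : g p = f p) (hq : g q = h q) :
    ∃ F : ℝ → E, Continuous F ∧ (∀ t ≤ p, F t = f t) ∧ (∀ t ∈ Icc p q, F t = g t) ∧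
      ∀ t ≥ q, F t = h t := by
  refine ⟨fun t => f (min t p) - f p + IccExtend hpq (fun t => g t) t + h (max t q) - h q,
    ?_, fun t ht => ?_, fun t ht => ?_, fun t ht => ?_⟩
  · have := (continuousOn_iff_continuous_domRestrict.1 hg).Icc_extend' (h := hpq)
    fun_prop
  · simp only [min_eq_left ht, IccExtend_of_le_left _ _ ht, hp,
      max_eq_right (ht.trans hpq)]
    abel
  · simp only [min_eq_right ht.1, IccExtend_of_mem _ _ ht, max_eq_right ht.2]
    abel
  · simp only [min_eq_right (hpq.trans ht), IccExtend_of_right_le _ _ ht, hq,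
      max_eq_left ht]
    abel

/-- The trapezoidal cutoff on the line which is `1` on `[-(r - 1), r - 1]` and `0` off
`[-r, r]`. -/
noncomputable def trapezoid (r t : ℝ) : ℂ := (max 0 (min 1 (r - |t|)) : ℝ)

theorem continuous_trapezoid (r : ℝ) : Continuous (trapezoid r) := by
  unfold trapezoid; fun_prop

theorem trapezoid_eq_one {r t : ℝ} (h : |t| ≤ r - 1) : trapezoid r t = 1 := by
  rw [trapezoid, min_eq_left (by linarith), max_eq_right zero_le_one, Complex.ofReal_one]

theorem trapezoid_eq_zero {r t : ℝ} (h : r ≤ |t|) : trapezoid r t = 0 := by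
  rw [trapezoid, max_eq_left ((min_le_right _ _).trans (by linarith)), Complex.ofReal_zero]

theorem hasCompactSupport_trapezoid (r : ℝ) : HasCompactSupport (trapezoid r) :=
  HasCompactSupport.intro (isCompact_Icc (a := -r) (b := r)) fun _ ht =>
    trapezoid_eq_zero (le_of_not_ge fun h => ht (abs_le.1 h))

/-- The real and imaginary parts of `z - a` are at most `R`, which leaves a gap `2 * R` out of `3 *
R`: the hypothesis of `tendstoUniformlyOn_gaussConv_const`. -/
theorem le_abs_sub_re_of_mem_closedBall {F : Type*} {a R : ℝ} {f : ℝ → F} {v : F}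
    (hf : ∀ t, |t - a| ≤ 3 * R → f t = v) :
    ∀ z ∈ closedBall (a : ℂ) R, ∀ t, f t ≠ v →
      2 * R ≤ |t - z.re| ∧ 2 * |z.im| ≤ |t - z.re| := by
  intro z hz t ht
  have h3 : 3 * R < |t - a| := lt_of_not_ge fun h => ht (hf t h)
  rw [mem_closedBall, dist_eq_norm] at hz
  have hre := (Complex.abs_re_le_norm (z - a)).trans hz
  have him := (Complex.abs_im_le_norm (z - a)).trans hz
  simp only [Complex.sub_re, Complex.ofReal_re, Complex.sub_im, Complex.ofReal_im,
    sub_zero] at hre him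
  have := abs_sub_le t z.re a
  constructor <;> linarith

/-- Simultaneous approximation of entire functions on two distant discs, and of a continuous
function on the segment that joins the centers. -/
theorem exists_entire_tendsto {E : Type*} [NormedAddCommGroup E] [NormedSpace ℂ E] [CompleteSpace E]
    {c₁ c₂ : ℂ → E}
    (hc₁ : Differentiable ℂ c₁) (hc₂ : Differentiable ℂ c₂) {R m : ℝ} (hR : 1 ≤ R)
    (hm : 8 * R ≤ m) {c : ℝ → E} (hc : Continuous c) (h1 : ∀ t ≤ 4 * R, c t = c₁ t)
    (h2 : ∀ t ≥ m - 4 * R, c t = c₂ t) :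
    ∃ d : ℝ → ℂ → E, (∀ b, Differentiable ℂ (d b)) ∧
      TendstoUniformlyOn d c₁ atTop (closedBall 0 R) ∧
      TendstoUniformlyOn d c₂ atTop (closedBall (m : ℂ) R) ∧
      TendstoUniformlyOn (fun b (t : ℝ) => d b t) c atTop (Icc 0 m) := by
  let η₁ : ℝ → ℂ := trapezoid (4 * R)
  let η₂ : ℝ → ℂ := fun t => trapezoid (4 * R) (t - m)
  have hη₁ : Continuous η₁ := continuous_trapezoid _
  have hη₂ : Continuous η₂ := (continuous_trapezoid _).comp (by fun_prop)
  have hη₁c : HasCompactSupport η₁ := hasCompactSupport_trapezoid _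
  have hη₂c : HasCompactSupport η₂ :=
    (hasCompactSupport_trapezoid _).comp_homeomorph (Homeomorph.subRight m)
  -- Only the cutoffs and this remainder are convolved, while `c₁` and `c₂` stay as entire factors.
  -- The weights tend to `1, 0, 0` on the first disc and `0, 1, 0` on the second; on the segment the
  -- sum tends to `c`.
  let ψ₀ : ℝ → E := fun t => c t - η₁ t • c₁ t - η₂ t • c₂ t
  -- Beyond the segment `ψ₀` need not vanish; clamping the argument gives compact support.
  let ψ : ℝ → E := fun t => ψ₀ (max 0 (min t m))
  have hψ₀ : Continuous ψ₀ := by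
    have := hc₁.continuous
    have := hc₂.continuous
    fun_prop
  have hψ : Continuous ψ := hψ₀.comp (by fun_prop)
  have hη₁0 : ∀ t, 4 * R ≤ t → η₁ t = 0 := fun t ht =>
    trapezoid_eq_zero (ht.trans (le_abs_self t))
  have hη₂0 : ∀ t, t ≤ m - 4 * R → η₂ t = 0 := fun t ht =>
    trapezoid_eq_zero (le_trans (by linarith) (neg_le_abs _))
  have hψ₀l : ∀ t ∈ Icc 0 (3 * R), ψ₀ t = 0 := fun t ht => by
    have e1 : η₁ t = 1 := trapezoid_eq_one (by rw [abs_of_nonneg ht.1]; linarith [ht.2])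
    simp only [ψ₀, h1 t (by linarith [ht.2]), e1, hη₂0 t (by linarith [ht.2]), one_smul, zero_smul,
      sub_self]
  have hψ₀r : ∀ t ∈ Icc (m - 3 * R) m, ψ₀ t = 0 := fun t ht => by
    have e1 : η₂ t = 1 :=
      trapezoid_eq_one (by rw [abs_of_nonpos (by linarith [ht.2])]; linarith [ht.1])
    simp only [ψ₀, h2 t (by linarith [ht.1]), e1, hη₁0 t (by linarith [ht.1]), one_smul, zero_smul,
      sub_zero, sub_self]
  have hψl : ∀ t ≤ 3 * R, ψ t = 0 := fun t ht =>
    hψ₀l _ ⟨le_max_left _ _, max_le (by linarith) ((min_le_left _ _).trans ht)⟩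
  have hψr : ∀ t ≥ m - 3 * R, ψ t = 0 := fun t ht =>
    hψ₀r _ ⟨le_max_of_le_right (le_min ht (by linarith)),
      max_le (by linarith) (min_le_right _ _)⟩
  have hψc : HasCompactSupport ψ :=
    HasCompactSupport.intro (isCompact_Icc (a := 3 * R) (b := m - 3 * R)) fun t ht => by
      by_contra h
      exact ht ⟨le_of_not_ge fun h' => h (hψl t h'), le_of_not_ge fun h' => h (hψr t h')⟩
  have hψeq : ∀ t ∈ Icc 0 m, ψ t = ψ₀ t := fun t ht => by
    simp only [ψ, min_eq_left ht.2, max_eq_right ht.1]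
  have hR2 : 0 < 2 * R := by linarith
  obtain ⟨M₁, hM₁⟩ := (isCompact_closedBall (0 : ℂ) (R + m)).exists_bound_of_continuousOn
    hc₁.continuous.continuousOn
  obtain ⟨M₂, hM₂⟩ := (isCompact_closedBall (0 : ℂ) (R + m)).exists_bound_of_continuousOn
    hc₂.continuous.continuousOn
  have hsum : ∀ {X : Type} (S : Set X) (j : X → ℂ) (u v : X → ℂ) (w : X → E),
      (∀ x ∈ S, j x ∈ closedBall (0 : ℂ) (R + m)) →
      TendstoUniformlyOn (fun b x => gaussConv η₁ b (j x)) u atTop S →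
      TendstoUniformlyOn (fun b x => gaussConv η₂ b (j x)) v atTop S →
      TendstoUniformlyOn (fun b x => gaussConv ψ b (j x)) w atTop S →
      TendstoUniformlyOn (fun b x => gaussConv η₁ b (j x) • c₁ (j x) + gaussConv η₂ b (j x) • c₂ (j x)
        + gaussConv ψ b (j x)) (fun x => u x • c₁ (j x) + v x • c₂ (j x) + w x) atTop S :=
    fun S j u v w hj hu hv hw =>
      ((hu.smul_bounded fun x hx => hM₁ _ (hj x hx)).add
        (hv.smul_bounded fun x hx => hM₂ _ (hj x hx))).add hw
  refine ⟨fun b z => gaussConv η₁ b z • c₁ z + gaussConv η₂ b z • c₂ z + gaussConv ψ b z,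
    fun b => ?_, ?_, ?_, ?_⟩
  · exact (((differentiable_gaussConv hη₁ hη₁c b).smul hc₁).add
      ((differentiable_gaussConv hη₂ hη₂c b).smul hc₂)).add (differentiable_gaussConv hψ hψc b)
  · rw [← Complex.ofReal_zero]
    refine (hsum _ (fun z => z) _ _ _
      (fun z hz => by
        rw [Complex.ofReal_zero] at hz
        exact closedBall_subset_closedBall (by linarith) hz)
      (tendstoUniformlyOn_gaussConv_const hη₁ hη₁c hR2 (le_abs_sub_re_of_mem_closedBall (v := 1) fun t ht =>
        trapezoid_eq_one (by rw [sub_zero] at ht; linarith)))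
      (tendstoUniformlyOn_gaussConv_const hη₂ hη₂c hR2 (le_abs_sub_re_of_mem_closedBall (v := 0) fun t ht =>
        hη₂0 t (by linarith [le_abs_self (t - 0)])))
      (tendstoUniformlyOn_gaussConv_const hψ hψc hR2 (le_abs_sub_re_of_mem_closedBall (v := 0) fun t ht =>
        hψl t (by linarith [le_abs_self (t - 0)])))).congr_right fun z _ => by simp
  · refine (hsum _ (fun z => z) _ _ _ (fun z hz => ?_)
      (tendstoUniformlyOn_gaussConv_const hη₁ hη₁c hR2 (le_abs_sub_re_of_mem_closedBall (v := 0) fun t ht =>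
        hη₁0 t (by linarith [neg_abs_le (t - m)])))
      (tendstoUniformlyOn_gaussConv_const hη₂ hη₂c hR2 (le_abs_sub_re_of_mem_closedBall (v := 1) fun t ht =>
        trapezoid_eq_one (by linarith)))
      (tendstoUniformlyOn_gaussConv_const hψ hψc hR2 (le_abs_sub_re_of_mem_closedBall (v := 0) fun t ht =>
        hψr t (by linarith [neg_abs_le (t - m)])))).congr_right fun z _ => by simp
    rw [mem_closedBall, dist_eq_norm] at hz ⊢
    have := norm_add_le (z - m) m
    rw [sub_add_cancel, Complex.norm_real, Real.norm_of_nonneg (by linarith)] at this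
    rw [sub_zero]
    linarith
  · refine (hsum (Icc 0 m) (fun t : ℝ => (t : ℂ)) η₁ η₂ ψ (fun t ht => ?_)
      (tendstoUniformly_gaussConv hη₁ hη₁c).tendstoUniformlyOn
      (tendstoUniformly_gaussConv hη₂ hη₂c).tendstoUniformlyOn
      (tendstoUniformly_gaussConv hψ hψc).tendstoUniformlyOn).congr_right fun t ht => ?_
    · rw [mem_closedBall, dist_zero_right, Complex.norm_real, Real.norm_of_nonneg ht.1]
      linarith [ht.2]
    · simp only [hψeq t ht, ψ₀]
      abel

/-- Fusion: an entire equation which is close to a first one near the origin, and whose solutions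
with the initial states of two given solutions of the first one are close, near a distant point,
to two given solutions of a second one. -/
theorem exists_fusion {c₁ x₁ y₁ c₂ x₂ y₂ : ℂ → ℂ × ℂ}
    (hc₁ : Differentiable ℂ c₁) (hx₁ : ∀ z, HasDerivAt x₁ (companion (c₁ z) (x₁ z)) z)
    (hy₁ : ∀ z, HasDerivAt y₁ (companion (c₁ z) (y₁ z)) z) (hw₁ : ∀ z, wronskian (x₁ z) (y₁ z) ≠ 0)
    (hc₂ : Differentiable ℂ c₂) (hx₂ : ∀ z, HasDerivAt x₂ (companion (c₂ z) (x₂ z)) z)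
    (hy₂ : ∀ z, HasDerivAt y₂ (companion (c₂ z) (y₂ z)) z) (hw₂ : ∀ z, wronskian (x₂ z) (y₂ z) ≠ 0)
    {R m : ℝ} (hR : 1 ≤ R) (hm : 8 * R < m) {ε : ℝ} (hε : 0 < ε) :
    ∃ d x y : ℂ → ℂ × ℂ, Differentiable ℂ d ∧ (∀ z, HasDerivAt x (companion (d z) (x z)) z) ∧
      (∀ z, HasDerivAt y (companion (d z) (y z)) z) ∧ x 0 = x₁ 0 ∧ y 0 = y₁ 0 ∧
      (∀ z ∈ closedBall (0 : ℂ) R, ‖d z - c₁ z‖ < ε) ∧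
      ∀ z ∈ closedBall (m : ℂ) R, ‖x z - x₂ z‖ < ε ∧ ‖y z - y₂ z‖ < ε := by
  have hpq : 4 * R < m - 4 * R := by linarith
  obtain ⟨c₀, x₀, y₀, hc₀, hc₀p, hc₀q, ⟨hx₀p, hy₀p, hx₀q, hy₀q⟩, hx₀, hy₀⟩ :=
    exists_connecting_coefficient hpq (hw₁ (4 * R : ℝ)) (hw₂ (m - 4 * R : ℝ)) (c₁ (4 * R : ℝ))
      (c₂ (m - 4 * R : ℝ))
  obtain ⟨c, hc, hcl, hcm, hcr⟩ := exists_continuous_glue hpq.le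
    (f := fun t : ℝ => c₁ t) (h := fun t : ℝ => c₂ t)
    (hc₁.continuous.comp Complex.continuous_ofReal) hc₀
    (hc₂.continuous.comp Complex.continuous_ofReal) hc₀p hc₀q
  obtain ⟨d, hd, hd₁, hd₂, hdc⟩ := exists_entire_tendsto hc₁ hc₂ hR hm.le hc hcl hcr
  choose x hx0 hx using fun b => exists_entire_solution (hd b) 0 (x₁ 0)
  choose y hy0 hy using fun b => exists_entire_solution (hd b) 0 (y₁ 0)
  -- Convergence travels over three consecutive intervals, to `u₁`, `u₀` and `u₂` in turn, each
  -- supplying the next initial value, and finally spreads over the disc about `m`.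
  have key : ∀ (u : ℝ → ℂ → ℂ × ℂ) (u₁ u₂ : ℂ → ℂ × ℂ) (u₀ : ℝ → ℂ × ℂ), (∀ b, u b 0 = u₁ 0) →
      (∀ b z, HasDerivAt (u b) (companion (d b z) (u b z)) z) →
      (∀ z, HasDerivAt u₁ (companion (c₁ z) (u₁ z)) z) →
      (∀ z, HasDerivAt u₂ (companion (c₂ z) (u₂ z)) z) →
      (∀ t ∈ Icc (4 * R) (m - 4 * R), HasDerivAt u₀ (companion (c₀ t) (u₀ t)) t) →
      u₀ (4 * R) = u₁ (4 * R : ℝ) → u₀ (m - 4 * R) = u₂ (m - 4 * R : ℝ) →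
      TendstoUniformlyOn u u₂ atTop (closedBall (m : ℂ) R) := by
    intro u u₁ u₂ u₀ hu0 hu hu₁ hu₂ hu₀ hp hq
    have hreal : ∀ {c u : ℂ → ℂ × ℂ}, (∀ z, HasDerivAt u (companion (c z) (u z)) z) → ∀ t : ℝ,
        HasDerivAt (fun t : ℝ => u t) (companion (c t) (u t)) t := fun h t => by
      have := (h (Complex.ofRealCLM t)).scomp t Complex.ofRealCLM.hasDerivAt
      simp only [Complex.ofRealCLM_apply, Complex.ofReal_one, one_smul] at this
      exact this
    have s1 : TendstoUniformlyOn (fun b (t : ℝ) => u b t) (fun t => u₁ t) atTop (Icc 0 (4 * R)) :=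
      tendstoUniformlyOn_Icc_of_companion (by linarith) (fun t _ => hreal hu₁ t)
        (fun b t _ => hreal (hu b) t) (hc₁.continuous.comp Complex.continuous_ofReal).continuousOn
        ((hdc.mono (Icc_subset_Icc_right (by linarith))).congr_right fun t ht => hcl t ht.2)
        (by simp [hu0])
    have s2 : TendstoUniformlyOn (fun b (t : ℝ) => u b t) u₀ atTop (Icc (4 * R) (m - 4 * R)) :=
      tendstoUniformlyOn_Icc_of_companion hpq.le hu₀ (fun b t _ => hreal (hu b) t) hc₀
        ((hdc.mono (Icc_subset_Icc (by linarith) (by linarith))).congr_right fun t ht => hcm t ht)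
        (by rw [hp]; exact s1.tendsto_at (right_mem_Icc.2 (by linarith)))
    have s3 : TendstoUniformlyOn (fun b (t : ℝ) => u b t) (fun t => u₂ t) atTop
        (Icc (m - 4 * R) m) :=
      tendstoUniformlyOn_Icc_of_companion (by linarith) (fun t _ => hreal hu₂ t)
        (fun b t _ => hreal (hu b) t) (hc₂.continuous.comp Complex.continuous_ofReal).continuousOn
        ((hdc.mono (Icc_subset_Icc_left (by linarith))).congr_right fun t ht => hcr t ht.1)
        (by rw [← hq]; exact s2.tendsto_at (right_mem_Icc.2 hpq.le))
    exact tendstoUniformlyOn_closedBall_of_companion (by linarith) (fun z _ => hu₂ z)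
      (fun b z _ => hu b z) hc₂.continuous.continuousOn hd₂
      (s3.tendsto_at (right_mem_Icc.2 (by linarith)))
  have hxlim := key x x₁ x₂ x₀ hx0 hx hx₁ hx₂ hx₀ hx₀p hx₀q
  have hylim := key y y₁ y₂ y₀ hy0 hy hy₁ hy₂ hy₀ hy₀p hy₀q
  rw [Metric.tendstoUniformlyOn_iff] at hxlim hylim hd₁
  obtain ⟨b, hb1, hb2, hb3⟩ := ((hxlim ε hε).and ((hylim ε hε).and (hd₁ ε hε))).exists
  simp only [dist_comm _ (x b _), dist_comm _ (y b _), dist_comm _ (d b _), dist_eq_norm] at hb1 hb2 hb3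
  exact ⟨d b, x b, y b, hd b, hx b, hy b, hx0 b, hy0 b, hb3, fun z hz => ⟨hb1 z hz, hb2 z hz⟩⟩

/-! ### Entire coefficients and a universal equation -/

/-- The entire functions with values in `ℂ × ℂ`. -/
def entireCoeff : Set C(ℂ, ℂ × ℂ) := {c | Differentiable ℂ c}

theorem isClosed_entireCoeff : IsClosed entireCoeff := by
  refine isClosed_of_closure_subset fun c hc => ?_
  obtain ⟨u, hu, hlim⟩ := mem_closure_iff_seq_limit.1 hc
  have := (tendstoLocallyUniformlyOn_univ.2
    (ContinuousMap.tendsto_iff_tendstoLocallyUniformly.1 hlim)).differentiableOn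
    (Eventually.of_forall fun n => (hu n).differentiableOn) isOpen_univ
  exact differentiableOn_univ.1 this

instance : BaireSpace entireCoeff :=
  have := isClosed_entireCoeff.isCompletelyPseudoMetrizableSpace
  inferInstance

namespace entireCoeff

theorem tendsto_iff {ι : Type*} {l : Filter ι} {c : ι → entireCoeff} {c₀ : entireCoeff} :
    Tendsto c l (𝓝 c₀) ↔
      ∀ r : ℝ, TendstoUniformlyOn (fun i => ⇑(c i).1) c₀.1 l (closedBall 0 r) := by
  rw [tendsto_subtype_rng, ContinuousMap.tendsto_iff_forall_isCompact_tendstoUniformlyOn]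
  refine ⟨fun h r => h _ (isCompact_closedBall _ _), fun h K hK => ?_⟩
  obtain ⟨r, hr⟩ := hK.isBounded.subset_closedBall 0
  exact (h r).mono hr

/-- The solution with the initial state `x₀` at the origin. -/
noncomputable def sol (c : entireCoeff) (x₀ : ℂ × ℂ) : ℂ → ℂ × ℂ :=
  (exists_entire_solution c.2 0 x₀).choose

theorem sol_zero (c : entireCoeff) (x₀ : ℂ × ℂ) : sol c x₀ 0 = x₀ :=
  (exists_entire_solution c.2 0 x₀).choose_spec.1

theorem hasDerivAt_sol (c : entireCoeff) (x₀ : ℂ × ℂ) (z : ℂ) :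
    HasDerivAt (sol c x₀) (companion (c.1 z) (sol c x₀ z)) z :=
  (exists_entire_solution c.2 0 x₀).choose_spec.2 z

theorem continuous_sol (c : entireCoeff) (x₀ : ℂ × ℂ) : Continuous (sol c x₀) :=
  continuous_iff_continuousAt.2 fun z => (hasDerivAt_sol c x₀ z).continuousAt

/-- Uniqueness is continuous dependence applied to a constant sequence. -/
theorem sol_eq (c : entireCoeff) {x : ℂ → ℂ × ℂ}
    (hx : ∀ z, HasDerivAt x (companion (c.1 z) (x z)) z) : sol c (x 0) = x := by
  ext1 z
  have := tendstoUniformlyOn_closedBall_of_companion (l := (atTop : Filter ℕ)) (norm_nonneg z)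
    (fun w _ => hasDerivAt_sol c (x 0) w) (fun _ w _ => hx w) c.1.continuous.continuousOn
    (d := fun _ => c.1) (y := fun _ => x) (z₀ := 0)
    (tendstoUniformlyOn_iff_tendstoUniformlyOnFilter.2 fun u hu =>
      Eventually.of_forall fun _ => refl_mem_uniformity hu)
    (by rw [sol_zero]; exact tendsto_const_nhds)
  exact tendsto_nhds_unique (this.tendsto_at (by simp)) tendsto_const_nhds

theorem tendstoUniformlyOn_sol (c : entireCoeff) (x₀ : ℂ × ℂ) (r : ℝ) :
    TendstoUniformlyOn (fun p : entireCoeff × (ℂ × ℂ) => sol p.1 p.2) (sol c x₀) (𝓝 (c, x₀))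
      (closedBall 0 r) := by
  refine TendstoUniformlyOn.mono (s := closedBall 0 |r|) ?_
    (closedBall_subset_closedBall (le_abs_self r))
  refine tendstoUniformlyOn_closedBall_of_companion (abs_nonneg r)
    (fun z _ => hasDerivAt_sol c x₀ z) (fun p z _ => hasDerivAt_sol p.1 p.2 z)
    c.1.continuous.continuousOn (tendsto_iff.1 (continuous_fst.tendsto (c, x₀)) _) ?_
  simp only [sol_zero]
  exact continuous_snd.tendsto (c, x₀)

theorem isOpen_setOf_sol_near (x₀ : ℂ × ℂ) (a : ℂ) {f : ℂ → ℂ × ℂ} (hf : Continuous f) (r ε : ℝ) :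
    IsOpen {c : entireCoeff | ∀ z ∈ closedBall 0 r, ‖sol c x₀ (z + a) - f z‖ < ε} := by
  rw [isOpen_iff_eventually]
  intro c hc
  -- By compactness the strict inequality leaves a uniform margin.
  obtain ⟨η, hη, hη'⟩ : ∃ η > 0, ∀ z ∈ closedBall 0 r, ‖sol c x₀ (z + a) - f z‖ + η < ε := by
    have hcont := continuous_sol c x₀
    rcases (closedBall (0 : ℂ) r).eq_empty_or_nonempty with h | h
    · exact ⟨1, one_pos, by simp [h]⟩
    obtain ⟨w, hw, hmax⟩ := (isCompact_closedBall (0 : ℂ) r).exists_isMaxOn h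
      (f := fun z => ‖sol c x₀ (z + a) - f z‖) (Continuous.continuousOn (by fun_prop))
    refine ⟨(ε - ‖sol c x₀ (w + a) - f w‖) / 2, by linarith [hc w hw], fun z hz => ?_⟩
    have h1 : ‖sol c x₀ (z + a) - f z‖ ≤ ‖sol c x₀ (w + a) - f w‖ := hmax hz
    linarith [hc w hw]
  have h1 := Metric.tendstoUniformlyOn_iff.1 (tendstoUniformlyOn_sol c x₀ (r + ‖a‖)) η hη
  filter_upwards [(Continuous.prodMk_left x₀).tendsto c |>.eventually h1] with c' hc' z hz
  have hza : z + a ∈ closedBall (0 : ℂ) (r + ‖a‖) := by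
    rw [mem_closedBall_zero_iff] at hz ⊢
    exact (norm_add_le _ _).trans (by linarith)
  have h2 := hc' _ hza
  rw [dist_comm, dist_eq_norm] at h2
  calc _ ≤ ‖sol c' x₀ (z + a) - sol c x₀ (z + a)‖ + ‖sol c x₀ (z + a) - f z‖ :=
        norm_sub_le_norm_sub_add_norm_sub _ _ _
    _ < _ := by linarith [hη' z hz]

/-- The linearly independent pairs of solutions of entire equations. -/
def target : Set (entireCoeff × (ℂ × ℂ) × (ℂ × ℂ)) := {d | wronskian d.2.1 d.2.2 ≠ 0}

/-- The equations some translate of which has fundamental solutions close to given ones. -/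
def visitors (d : entireCoeff × (ℂ × ℂ) × (ℂ × ℂ)) (r ε : ℝ) : Set entireCoeff :=
  {c | ∃ n : ℕ, 1 ≤ n ∧ (∀ z ∈ closedBall 0 r, ‖sol c (1, 0) (z + n) - sol d.1 d.2.1 z‖ < ε) ∧
    ∀ z ∈ closedBall 0 r, ‖sol c (0, 1) (z + n) - sol d.1 d.2.2 z‖ < ε}

theorem isOpen_visitors (d : entireCoeff × (ℂ × ℂ) × (ℂ × ℂ)) (r ε : ℝ) :
    IsOpen (visitors d r ε) := by
  have : visitors d r ε = ⋃ n : ℕ, ⋃ _ : 1 ≤ n,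
      {c : entireCoeff | ∀ z ∈ closedBall 0 r, ‖sol c (1, 0) (z + n) - sol d.1 d.2.1 z‖ < ε} ∩
      {c | ∀ z ∈ closedBall 0 r, ‖sol c (0, 1) (z + n) - sol d.1 d.2.2 z‖ < ε} := by
    ext c
    simp only [visitors, mem_iUnion, mem_inter_iff, mem_ofPred_eq, exists_prop]
  rw [this]
  exact isOpen_iUnion fun n => isOpen_iUnion fun _ =>
    (isOpen_setOf_sol_near _ _ (continuous_sol _ _) _ _).inter
      (isOpen_setOf_sol_near _ _ (continuous_sol _ _) _ _)

theorem wronskian_sol_ne_zero (c : entireCoeff) {x₀ y₀ : ℂ × ℂ} (h : wronskian x₀ y₀ ≠ 0) (z : ℂ) :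
    wronskian (sol c x₀ z) (sol c y₀ z) ≠ 0 :=
  wronskian_ne_zero c.2 (hasDerivAt_sol c x₀) (hasDerivAt_sol c y₀) (z₀ := 0)
    (by rwa [sol_zero, sol_zero]) z

theorem wronskian_one_zero_ne_zero : wronskian (1, 0) (0, 1) ≠ 0 := by simp [wronskian]

/-- Fusing `c` with a distant translate of the target equation changes `c` very little on a large
disc and keeps the initial states at the origin. -/
theorem dense_visitors {d : entireCoeff × (ℂ × ℂ) × (ℂ × ℂ)} (hd : d ∈ target) (r : ℝ) {ε : ℝ}
    (hε : 0 < ε) : Dense (visitors d r ε) := by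
  intro c
  have hstep : ∀ k : ℕ, ∃ c' ∈ visitors d r ε, ∀ z ∈ closedBall 0 (k : ℝ),
      ‖c'.1 z - c.1 z‖ < 1 / ((k : ℝ) + 1) := by
    intro k
    -- Large enough for the target disc, for the disc of radius `k` where `c'` must be close to `c`,
    -- and for `1 ≤ R`.
    set R : ℝ := max r (k + 1) with hR
    have hR1 : 1 ≤ R := le_max_of_le_right (by simp)
    obtain ⟨n, hn⟩ := exists_nat_gt (8 * R)
    have hsub : ∀ u₀ z, HasDerivAt (fun z => sol d.1 u₀ (z - n))
        (companion (d.1.1 (z - n)) (sol d.1 u₀ (z - n))) z := fun u₀ z =>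
      (hasDerivAt_sol d.1 u₀ (z - n)).comp_sub_const z n
    obtain ⟨e, x, y, he, hx, hy, hx0, hy0, hec, hxy⟩ := exists_fusion c.2
      (hasDerivAt_sol c (1, 0)) (hasDerivAt_sol c (0, 1))
      (wronskian_sol_ne_zero c wronskian_one_zero_ne_zero)
      (c₂ := fun z => d.1.1 (z - n)) (d.1.2.comp (differentiable_id.sub_const _))
      (hsub d.2.1) (hsub d.2.2) (fun z => wronskian_sol_ne_zero d.1 hd (z - n)) hR1 hn
      (ε := min ε (1 / ((k : ℝ) + 1))) (by positivity)
    rw [sol_zero] at hx0 hy0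
    let c' : entireCoeff := ⟨⟨e, he.continuous⟩, he⟩
    have hxs : sol c' (1, 0) = x := by rw [← hx0]; exact sol_eq c' hx
    have hys : sol c' (0, 1) = y := by rw [← hy0]; exact sol_eq c' hy
    have hball : ∀ z ∈ closedBall (0 : ℂ) r, z + n ∈ closedBall ((n : ℝ) : ℂ) R := fun z hz => by
      rw [mem_closedBall_zero_iff] at hz
      rw [mem_closedBall, dist_eq_norm, Complex.ofReal_natCast, add_sub_cancel_right]
      exact hz.trans (le_max_left _ _)
    refine ⟨c', ⟨n, ?_, fun z hz => ?_, fun z hz => ?_⟩, fun z hz => ?_⟩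
    · have : (0 : ℝ) < n := by linarith
      exact_mod_cast this
    · have := (hxy _ (hball z hz)).1
      rw [add_sub_cancel_right] at this
      rw [hxs]
      exact this.trans_le (min_le_left _ _)
    · have := (hxy _ (hball z hz)).2
      rw [add_sub_cancel_right] at this
      rw [hys]
      exact this.trans_le (min_le_left _ _)
    · exact (hec z (closedBall_subset_closedBall
        ((le_add_of_nonneg_right zero_le_one).trans (le_max_right _ _)) hz)).trans_le
        (min_le_right _ _)
  choose c' hc' hlim using hstep
  refine mem_closure_of_tendsto (b := atTop) (tendsto_iff.2 fun s => ?_) (Eventually.of_forall hc')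
  rw [Metric.tendstoUniformlyOn_iff]
  intro δ hδ
  filter_upwards [eventually_ge_atTop ⌈s⌉₊,
    (tendsto_order.1 tendsto_one_div_add_atTop_nhds_zero_nat).2 δ hδ] with k hk hkδ z hz
  rw [dist_comm, dist_eq_norm]
  exact (hlim k z (closedBall_subset_closedBall (Nat.ceil_le.1 hk) hz)).trans hkδ

/-- There is an entire equation whose translates by positive integers approximate all entire
equations together with their fundamental solutions. -/
theorem exists_universal : ∃ c : entireCoeff, ∀ d ∈ target, ∀ r : ℝ, ∀ ε > 0, c ∈ visitors d r ε := by
  obtain ⟨D, hDc, hD⟩ := exists_countable_dense target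
  have := hDc.to_subtype
  -- One integer serves both as radius and as reciprocal accuracy, so countably many open dense
  -- conditions suffice.
  have hdense : Dense (⋂ p : D × ℕ, visitors p.1.1.1 p.2 (1 / ((p.2 : ℝ) + 1))) :=
    dense_iInter_of_isOpen (fun p => isOpen_visitors _ _ _)
      (fun p => dense_visitors p.1.1.2 _ (by positivity))
  have : Nonempty entireCoeff := ⟨⟨0, differentiable_const 0⟩⟩
  obtain ⟨c, hc⟩ := hdense.nonempty
  rw [mem_iInter] at hc
  refine ⟨c, fun d hd r ε hε => ?_⟩
  have h1 : ∀ f : entireCoeff × (ℂ × ℂ) × (ℂ × ℂ) → ℂ × ℂ, Continuous f →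
      ∀ᶠ d' : target in 𝓝 ⟨d, hd⟩, ∀ z ∈ closedBall 0 r,
        dist (sol d.1 (f d) z) (sol d'.1.1 (f d'.1) z) < ε / 2 := fun f hf =>
    (Continuous.tendsto (f := fun d' : target => (d'.1.1, f d'.1)) (by fun_prop) ⟨d, hd⟩).eventually
      (Metric.tendstoUniformlyOn_iff.1 (tendstoUniformlyOn_sol d.1 (f d) r) (ε / 2) (by positivity))
  obtain ⟨d', ⟨hd1, hd2⟩, hd'⟩ := mem_closure_iff_nhds.1 (hD ⟨d, hd⟩) _
    ((h1 (fun d => d.2.1) (by fun_prop)).and (h1 (fun d => d.2.2) (by fun_prop)))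
  obtain ⟨m, hmr, hmε⟩ := ((eventually_ge_atTop ⌈r⌉₊).and
    ((tendsto_order.1 tendsto_one_div_add_atTop_nhds_zero_nat).2 (ε / 2) (by positivity))).exists
  obtain ⟨n, hn, hx, hy⟩ := hc (⟨d', hd'⟩, m)
  have hsub : closedBall (0 : ℂ) r ⊆ closedBall 0 m :=
    closedBall_subset_closedBall (Nat.ceil_le.1 hmr)
  have htri : ∀ u v w : ℂ × ℂ, ‖u - v‖ < 1 / ((m : ℝ) + 1) → dist w v < ε / 2 → ‖u - w‖ < ε :=
    fun u v w h h' => by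
      rw [dist_comm, dist_eq_norm] at h'
      linarith [norm_sub_le_norm_sub_add_norm_sub u v w]
  exact ⟨n, hn, fun z hz => htri _ _ _ (hx z (hsub hz)) (hd1 z hz),
    fun z hz => htri _ _ _ (hy z (hsub hz)) (hd2 z hz)⟩

end entireCoeff

/-! ### The universal locally univalent function. -/

theorem mainTheorem9 :
    ∃ f : LocallyUnivalentFunction ⊤,
      ∀ Ω : Opens ℂ, IsSimplyConnected (Ω : Set ℂ) →
        Dense {g : LocallyUnivalentFunction Ω |
          ∃ n : ℕ, 1 ≤ n ∧ g = f.translate (n : ℂ) Ω} := by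
  obtain ⟨c, hc⟩ := entireCoeff.exists_universal
  obtain ⟨f, hf⟩ := exists_locallyUnivalent_of_companion (entireCoeff.hasDerivAt_sol c (1, 0))
    (entireCoeff.hasDerivAt_sol c (0, 1))
    (entireCoeff.wronskian_sol_ne_zero c entireCoeff.wronskian_one_zero_ne_zero)
  refine ⟨f, fun Ω hΩ => dense_locallyUnivalentFunction fun g K hK hKΩ ε hε => ?_⟩
  obtain ⟨d, x, y, hd, hx, hy, hw, hg⟩ := g.exists_entire_approx hΩ hK hKΩ (half_pos hε)
  have hxc : Continuous x := continuous_iff_continuousAt.2 fun z => (hx z).continuousAt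
  have hyc : Continuous y := continuous_iff_continuousAt.2 fun z => (hy z).continuousAt
  obtain ⟨m, hm, hmK⟩ := exists_pos_forall_le_norm hK (u := fun z => ((x z).1, (y z).1))
    (Continuous.continuousOn (by fun_prop)) fun z _ => fst_ne_zero_of_wronskian (hw z)
  obtain ⟨r, hr⟩ := hK.isBounded.subset_closedBall 0
  let d' : entireCoeff := ⟨⟨d, hd.continuous⟩, hd⟩
  -- The accuracy `m * (ε / 4)` becomes `ε / 2` on the sphere through the factor `2 / ‖v‖` of
  -- `dist_proj_le`.
  obtain ⟨n, hn, hxn, hyn⟩ := hc (d', x 0, y 0) (hw 0) r (m * (ε / 4)) (by positivity)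
  rw [show entireCoeff.sol d' (x 0) = x from entireCoeff.sol_eq d' hx] at hxn
  rw [show entireCoeff.sol d' (y 0) = y from entireCoeff.sol_eq d' hy] at hyn
  refine ⟨f.translate n Ω, ⟨n, hn, rfl⟩, fun z hz => ?_⟩
  have hfz : (f.translate n Ω).1 z = proj ((entireCoeff.sol c (1, 0) (z + n)).1,
      (entireCoeff.sol c (0, 1) (z + n)).1) := hf ⟨(z : ℂ) + n, trivial⟩
  have hmz := hmK z hz
  set v : ℂ × ℂ := ((x z).1, (y z).1)
  set w : ℂ × ℂ := ((entireCoeff.sol c (1, 0) (z + n)).1, (entireCoeff.sol c (0, 1) (z + n)).1)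
  have hvw : ‖v - w‖ < m * (ε / 4) := by
    rw [norm_sub_rev]
    refine (Prod.norm_mk _ _).trans_lt (max_lt ?_ ?_)
    · exact (norm_fst_le (entireCoeff.sol c (1, 0) (z + n) - x z)).trans_lt (hxn z (hr hz))
    · exact (norm_fst_le (entireCoeff.sol c (0, 1) (z + n) - y z)).trans_lt (hyn z (hr hz))
  have hdist : dist (proj v) (proj w) < ε / 2 := by
    refine (dist_proj_le (fst_ne_zero_of_wronskian (hw z)) (fst_ne_zero_of_wronskian
      (entireCoeff.wronskian_sol_ne_zero c entireCoeff.wronskian_one_zero_ne_zero _))).trans_lt ?_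
    rw [div_lt_iff₀ (hm.trans_le hmz)]
    nlinarith
  rw [hfz]
  calc _ ≤ dist (proj v) (proj w) + dist (proj v) (g.1 z) := dist_triangle_left _ _ _
    _ < ε := by linarith [hg z hz]
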